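/- Consider the binary symmetric channel (BSC) with crossover probability $p$, $0<p<\tfrac12$, used $n$ times: inputs and outputs are $x,y\in\{\pm1\}^n$ and $p_{y|x}(b|a)=(1-p)^n\left(\frac{p}{1-p}\right)^{d_H(a,b)}$, where $d_H$ is the Hamming distance. Let $p_y(b)=2^{-n}$ be the capacity-achieving output distribution and $\Lambda(a,b)=\frac1n\ln\frac{p_{y|x}(b|a)}{p_y(b)}$. For a rate $R\in\mathbb R$ (in bits per channel use), the random coding union (RCU) bound on the average error probability is $$\overline P_e(n,R)=\mathbb E\left[\min\left(1,\,2^{nR}g(x,y)\right)\right],\qquad g(x,y)=\mathbb P_z\left[\Lambda(z,y)\ge\Lambda(x,y)\right],$$ where $x$ and $z$ are uniform on $\{\pm1\}^n$ and $y$ is the channel output for input $x$. **Theorem.** Fix $0<p<\tfrac12$ and $0<P_e<1$. For every $n\ge1$ there is a largest rate $\underline R=\underline R(n,P_e)$ with $\overline P_e(n,\underline R)\le P_e$, and it is the unique solution $R$ of $\overline P_e(n,R)=P_e$; this is the RCU lower bound on the best achievable rate. It is consistent with the normal approximation, that is, $$\underline R=C-\sqrt{\frac Vn}\,\log_2(e)\,Q^{-1}(P_e)+\frac{\log_2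 n}{2n}+O\left(\frac1n\right)\qquad(n\to\infty),$$ where $C=1+p\log_2p+(1-p)\log_2(1-p)$ is the capacity, $V=p(1-p)\ln^2\frac{1-p}{p}$ is the dispersion, and $Q^{-1}$ is the inverse of $Q(t)=\mathbb P[N(0,1)>t]$. -/

import Mathlib

open Filter Asymptotics ProbabilityTheory

noncomputable section

/-- The log-likelihood function `Λ(a, b) = (1/n) ln (p_{y|x}(b|a) / p_y(b))` of a channel with
transition probabilities `W a b = p_{y|x}(b|a)` and reference output probabilities `Py b`,
for blocklength `n`. -/
def logLikelihood {X Y : Type*} (n : ℕ) (W : X → Y → ℝ) (Py : Y → ℝ) (a : X) (b : Y) : ℝ :=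
  1 / (n : ℝ) * Real.log (W a b / Py b)

open Classical in
/-- The pairwise error function `g(x, y) = P[Λ(z, y) ≥ Λ(x, y)]`, where `z` is uniform on the
finite set `X` of codewords. -/
def pairwiseError {X Y : Type*} [Fintype X] (n : ℕ) (W : X → Y → ℝ) (Py : Y → ℝ)
    (x : X) (y : Y) : ℝ :=
  (Finset.univ.filter fun z : X => logLikelihood n W Py x y ≤ logLikelihood n W Py z y).card
    / (Fintype.card X : ℝ)

/-- The random coding union (RCU) bound on the average error probability at rate `R` (in bits per
channel use): `E[min(1, 2^{nR} g(x, y))]`, where `x` is uniform on the finite set `X` of codewords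
and `y` is the channel output for the input `x`. -/
def rcuBound {X Y : Type*} [Fintype X] [Fintype Y] (n : ℕ) (W : X → Y → ℝ) (Py : Y → ℝ)
    (R : ℝ) : ℝ :=
  ∑ x : X, 1 / (Fintype.card X : ℝ) *
    ∑ y : Y, W x y * min 1 ((2 : ℝ) ^ ((n : ℝ) * R) * pairwiseError n W Py x y)

/-- Transition probabilities of `n` uses of the binary symmetric channel with crossover
probability `p`; the alphabet `{1, -1}` is the type `ℤˣ`. -/
def bscTransition (p : ℝ) (n : ℕ) (a b : Fin n → ℤˣ) : ℝ :=
  (1 - p) ^ n * (p / (1 - p)) ^ hammingDist b a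

/-- The capacity-achieving output distribution of the binary symmetric channel (uniform). -/
def bscOutput (n : ℕ) (_b : Fin n → ℤˣ) : ℝ := (1 / 2) ^ n

/-- The RCU bound for the binary symmetric channel, as a function of the rate `R`. -/
def bscRCU (p : ℝ) (n : ℕ) (R : ℝ) : ℝ :=
  rcuBound n (bscTransition p n) (bscOutput n) R

/-- The RCU lower bound on the best achievable rate, for a given error probability `Pe`: the
largest rate at which the RCU bound guarantees an error probability of at most `Pe`. -/
def bscRCURate (p : ℝ) (n : ℕ) (Pe : ℝ) : ℝ :=
  sSup {R : ℝ | bscRCU p n R ≤ Pe}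

/-- The Gaussian tail function `Q(x) = P[N(0,1) > x]`. -/
def gaussianQ (x : ℝ) : ℝ := (gaussianReal 0 1).real (Set.Ioi x)

/-- The inverse `Q⁻¹` of the (injective) Gaussian tail function. -/
def gaussianQInv : ℝ → ℝ := Function.invFun gaussianQ

/-- The inverse is a genuine one for all probabilities strictly between `0` and `1`. -/
theorem gaussianQ_gaussianQInv {e : ℝ} (h0 : 0 < e) (h1 : e < 1) :
    gaussianQ (gaussianQInv e) = e := by
  apply Function.invFun_eq
  have hQ : ∀ x, gaussianQ x = 1 - cdf (gaussianReal 0 1) x := by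
    intro x
    rw [cdf_eq_real, gaussianQ, ← Set.compl_Iic, MeasureTheory.probReal_compl_eq_one_sub
      measurableSet_Iic]
  have hc : Continuous (cdf (gaussianReal 0 1)) := by
    rw [continuous_iff_continuousAt]
    intro x
    rw [(cdf (gaussianReal 0 1)).mono.continuousAt_iff_leftLim_eq_rightLim,
      StieltjesFunction.rightLim_eq]
    have h := StieltjesFunction.measure_singleton (cdf (gaussianReal 0 1)) x
    have := nullSingletonClass_gaussianReal (μ := 0) (v := 1) one_ne_zero
    rw [measure_cdf, MeasureTheory.measure_singleton, eq_comm, ENNReal.ofReal_eq_zero] at h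
    exact le_antisymm ((cdf (gaussianReal 0 1)).mono.leftLim_le le_rfl) (by linarith)
  obtain ⟨a, ha⟩ := ((tendsto_cdf_atBot (gaussianReal 0 1)).eventually_lt_const
    (show 0 < 1 - e by linarith)).exists
  obtain ⟨b, hb⟩ := ((tendsto_cdf_atTop (gaussianReal 0 1)).eventually_const_lt
    (show 1 - e < 1 by linarith)).exists
  obtain ⟨t, ht⟩ := mem_range_of_exists_le_of_exists_ge hc ⟨a, ha.le⟩ ⟨b, hb.le⟩
  exact ⟨t, by rw [hQ, ht]; ring⟩

/-- The normal approximation `C - √(V/n) log₂(e) Q⁻¹(Pe) + log₂(n)/(2n)`, in bits per channel use,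
for capacity `C` (in bits) and dispersion `V` (in squared nats). -/
def normalApprox (C V : ℝ) (n : ℕ) (Pe : ℝ) : ℝ :=
  C - Real.sqrt (V / n) * Real.logb 2 (Real.exp 1) * gaussianQInv Pe
    + Real.logb 2 n / (2 * n)

/-- Capacity `1 - h(p)` of the binary symmetric channel, `h` being the binary entropy in bits. -/
def bscCapacity (p : ℝ) : ℝ := 1 - Real.binEntropy p / Real.log 2

/-- Dispersion of the binary symmetric channel. -/
def bscDispersion (p : ℝ) : ℝ := p * (1 - p) * Real.log ((1 - p) / p) ^ 2

end

/-!
For the BSC the event `Λ(z, y) ≥ Λ(x, y)` says that `z` is at least as close to `y` as `x` is. The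
RCU bound is therefore the mean of `min(1, 2^{nR} G(k))`, where `k` is binomial with parameters `n`,
`p` and `G(k)` is the proportion of `{±1}ⁿ` in a Hamming ball of radius `k`. At radii up to a fixed
fraction of `n` below `n / 2`, the function `G` decays at least geometrically as the radius
decreases, so the truncation acts like a threshold: the bound is the probability that `k` exceeds a
point `K` with `2^{nR} G(K) ≈ 1`, up to `O(1/√n)`.

The Berry–Esseen bound `P[k > np + z √(np(1-p))] = Q(z) + O(1/√n)` follows by Stein's method from
the identity `E[(k - np) g(k)] = E[p (n - k) (g(k + 1) - g(k))]` (summation by parts). Near the mean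
the binomial masses are of exact order `1/√n`, by Stirling's formula, so an error `O(1/√n)` in
probability is absorbed by moving `K` by `O(1)`, which changes `2^{nR}` by a bounded factor, that
is, `R` by `O(1/n)`. Finally `2^{nR} C(n, k) / 2^n = √n P[k] ((1-p)/p)^{k - np - z √(np(1-p))}` when
`R` is the normal approximation with `z = Q⁻¹(Pe)`; the factor `√n` cancels the `1/√n` of the mass,
and this is the origin of the term `log₂(n) / (2n)`.
-/

open Finset Real Topology

section Binomial

/-- The probability mass function of the binomial distribution with `n` trials of success
probability `p`. -/
noncomputable def binomialMass (p : ℝ) (n k : ℕ) : ℝ :=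
  n.choose k * p ^ k * (1 - p) ^ (n - k)

/-- The probability that a binomial random variable with parameters `n`, `p` exceeds `x`. -/
noncomputable def binomialTail (p : ℝ) (n : ℕ) (x : ℝ) : ℝ :=
  ∑ k ∈ range (n + 1) with x < (k : ℕ), binomialMass p n k

variable {p : ℝ} {n k : ℕ}

lemma binomialMass_pos (hp0 : 0 < p) (hp1 : p < 1) (hk : k ≤ n) : 0 < binomialMass p n k := by
  have : 0 < 1 - p := sub_pos.mpr hp1
  have hc : 0 < n.choose k := Nat.choose_pos hk
  unfold binomialMass
  positivity

lemma binomialMass_nonneg (hp0 : 0 ≤ p) (hp1 : p ≤ 1) (n k : ℕ) : 0 ≤ binomialMass p n k := by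
  have : 0 ≤ 1 - p := sub_nonneg.mpr hp1
  unfold binomialMass
  positivity

lemma binomialMass_eq_zero_of_lt (p : ℝ) (h : n < k) : binomialMass p n k = 0 := by
  simp [binomialMass, Nat.choose_eq_zero_of_lt h]

lemma binomialMass_symm (p : ℝ) (hk : k ≤ n) :
    binomialMass p n k = binomialMass (1 - p) n (n - k) := by
  rw [binomialMass, binomialMass, Nat.choose_symm hk, Nat.sub_sub_self hk, sub_sub_cancel]
  ring

lemma binomialTail_natFloor {x : ℝ} (hx : 0 ≤ x) :
    binomialTail p n ⌊x⌋₊ = binomialTail p n x := by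
  simp only [binomialTail, Nat.cast_lt, Nat.floor_lt hx]

lemma sum_binomialMass (p : ℝ) (n : ℕ) : ∑ k ∈ range (n + 1), binomialMass p n k = 1 :=
  calc ∑ k ∈ range (n + 1), binomialMass p n k = (p + (1 - p)) ^ n := by
        rw [add_pow]
        exact sum_congr rfl fun k _ => by rw [binomialMass]; ring
    _ = 1 := by rw [add_sub_cancel, one_pow]

lemma binomialMass_succ (p : ℝ) (hk : k < n) :
    binomialMass p n (k + 1) * ((1 - p) * (k + 1)) = binomialMass p n k * (p * (n - k)) := by
  have hchoose : (n.choose (k + 1) : ℝ) * (k + 1) = n.choose k * (n - k) := by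
    rw [← Nat.cast_sub hk.le]
    exact_mod_cast Nat.choose_succ_right_eq n k
  have hexp : n - k = n - (k + 1) + 1 := by omega
  rw [binomialMass, binomialMass, hexp, pow_succ, pow_succ]
  linear_combination (p ^ k * p * (1 - p) ^ (n - (k + 1)) * (1 - p)) * hchoose

lemma sum_binomialMass_mul_sub (p : ℝ) (n : ℕ) (g : ℕ → ℝ) :
    ∑ k ∈ range (n + 1), binomialMass p n k * ((k - n * p) * g k) =
      ∑ k ∈ range (n + 1), binomialMass p n k * (p * (n - k) * (g (k + 1) - g k)) := by
  have hshift : ∑ k ∈ range (n + 1), binomialMass p n k * ((1 - p) * k) * g k =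
      ∑ k ∈ range (n + 1), binomialMass p n k * (p * (n - k)) * g (k + 1) := by
    rw [sum_range_succ', sum_range_succ]
    simp only [Nat.cast_zero, mul_zero, zero_mul, add_zero, sub_self]
    refine sum_congr rfl fun k hk => ?_
    rw [← binomialMass_succ p (mem_range.mp hk), Nat.cast_add_one]
  rw [← sub_eq_zero, ← sum_sub_distrib] at hshift ⊢
  rw [← hshift]
  exact sum_congr rfl fun k _ => by ring

lemma sum_binomialMass_mul_centered (p : ℝ) (n : ℕ) :
    ∑ k ∈ range (n + 1), binomialMass p n k * (k - n * p) = 0 := by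
  simpa using sum_binomialMass_mul_sub p n fun _ => 1

lemma sum_binomialMass_mul_centered_sq (p : ℝ) (n : ℕ) :
    ∑ k ∈ range (n + 1), binomialMass p n k * (k - n * p) ^ 2 = n * p * (1 - p) :=
  calc ∑ k ∈ range (n + 1), binomialMass p n k * (k - n * p) ^ 2
      = ∑ k ∈ range (n + 1), binomialMass p n k * (p * (n - k)) := by
        simpa [sq] using sum_binomialMass_mul_sub p n fun k => k - n * p
    _ = p * (n - n * p) * ∑ k ∈ range (n + 1), binomialMass p n k -
          p * ∑ k ∈ range (n + 1), binomialMass p n k * (k - n * p) := by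
        rw [mul_sum, mul_sum, ← sum_sub_distrib]
        exact sum_congr rfl fun k _ => by ring
    _ = n * p * (1 - p) := by
        rw [sum_binomialMass, sum_binomialMass_mul_centered]
        ring

end Binomial

section LocalBounds

open scoped Nat

lemma factorial_le_exp_one_mul_sqrt_mul_pow {n : ℕ} (hn : n ≠ 0) :
    (n ! : ℝ) ≤ exp 1 * √n * (n / exp 1) ^ n := by
  obtain ⟨m, rfl⟩ := Nat.exists_eq_succ_of_ne_zero hn
  have hle : Stirling.stirlingSeq m.succ ≤ exp 1 / √2 := by
    simpa [Stirling.stirlingSeq_one] using Stirling.stirlingSeq'_antitone (Nat.zero_le m)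
  rw [Stirling.stirlingSeq, div_le_iff₀ (by positivity)] at hle
  calc (m.succ ! : ℝ) ≤ exp 1 / √2 * (√(2 * m.succ) * (m.succ / exp 1) ^ m.succ) := by
        exact_mod_cast hle
    _ = exp 1 * √m.succ * (m.succ / exp 1) ^ m.succ := by
        rw [sqrt_mul zero_le_two]
        field_simp

lemma pow_le_pow_mul_exp_sub {x y : ℝ} (hx : 0 ≤ x) (hy : 0 < y) (m : ℕ) :
    x ^ m ≤ y ^ m * exp (m * (x / y - 1)) := by
  have hle : x ≤ y * exp (x / y - 1) := by
    rw [← div_le_iff₀' hy]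
    simpa using add_one_le_exp (x / y - 1)
  calc x ^ m ≤ (y * exp (x / y - 1)) ^ m := by gcongr
    _ = y ^ m * exp (m * (x / y - 1)) := by rw [mul_pow, ← exp_nat_mul]

lemma pow_div_factorial_le {x : ℝ} (hx : 0 ≤ x) {m : ℕ} (hm : 0 < m) :
    x ^ m / m ! ≤ exp x / √(2 * π * m) := by
  have hpow : x ^ m ≤ exp x * (m / exp 1) ^ m :=
    calc x ^ m ≤ m ^ m * exp (m * (x / m - 1)) := pow_le_pow_mul_exp_sub hx (by positivity) m
      _ = exp x * (m / exp 1) ^ m := by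
        rw [div_pow, ← exp_nat_mul, mul_one, mul_sub, mul_div_cancel₀ x (by positivity), mul_one,
          exp_sub]
        ring
  rw [div_le_div_iff₀ (by positivity) (by positivity)]
  calc x ^ m * √(2 * π * m) ≤ exp x * (m / exp 1) ^ m * √(2 * π * m) := by gcongr
    _ = exp x * (√(2 * π * m) * (m / exp 1) ^ m) := by ring
    _ ≤ exp x * m ! := by gcongr; exact Stirling.le_factorial_stirling m

lemma le_pow_div_factorial {x : ℝ} (hx : 0 < x) {m : ℕ} (hm : 0 < m) :
    exp (x - (m - x) ^ 2 / x) / (exp 1 * √m) ≤ x ^ m / m ! := by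
  have hpow : exp (x - (m - x) ^ 2 / x) * (m / exp 1) ^ m ≤ x ^ m :=
    calc exp (x - (m - x) ^ 2 / x) * (m / exp 1) ^ m
        = exp (2 * m - m ^ 2 / x) * (m ^ m / exp m) := by
          rw [div_pow, ← exp_nat_mul, mul_one]
          congr 2
          field_simp
          ring
      _ ≤ exp (2 * m - m ^ 2 / x) * (x ^ m * exp (m * (m / x - 1)) / exp m) := by
          gcongr
          exact pow_le_pow_mul_exp_sub (by positivity) hx m
      _ = x ^ m := by
          rw [mul_div_assoc, ← exp_sub, mul_left_comm, ← exp_add]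
          ring_nf
          simp
  rw [div_le_div_iff₀ (by positivity) (by positivity)]
  calc exp (x - (m - x) ^ 2 / x) * m !
      ≤ exp (x - (m - x) ^ 2 / x) * (exp 1 * √m * (m / exp 1) ^ m) := by
        gcongr
        exact factorial_le_exp_one_mul_sqrt_mul_pow hm.ne'
    _ = exp (x - (m - x) ^ 2 / x) * (m / exp 1) ^ m * (exp 1 * √m) := by ring
    _ ≤ x ^ m * (exp 1 * √m) := by gcongr

variable {p : ℝ} {n k : ℕ}

-- The weights `x ^ m / m !` are Poisson masses up to `exp (-x)`: a binomial variable is a Poisson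
-- variable conditioned on its sum with an independent one.
lemma binomialMass_mul_pow_div_factorial (p : ℝ) (hk : k ≤ n) :
    binomialMass p n k * (n ^ n / n !) =
      (n * p) ^ k / k ! * ((n * (1 - p)) ^ (n - k) / (n - k)!) := by
  have hpow : (n : ℝ) ^ n = n ^ k * n ^ (n - k) := by rw [← pow_add, Nat.add_sub_cancel' hk]
  rw [binomialMass, Nat.cast_choose ℝ hk, hpow, mul_pow, mul_pow]
  field_simp

lemma binomialMass_le_of_pos_of_lt (hp0 : 0 ≤ p) (hp1 : p ≤ 1) (hk0 : 0 < k) (hkn : k < n) :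
    binomialMass p n k ≤ exp 1 / (2 * π) * (√n / (√k * √(n - k : ℕ))) := by
  have hn : 0 < n := hk0.trans hkn
  have hden : exp n / (exp 1 * √n) ≤ (n : ℝ) ^ n / n ! := by
    simpa using le_pow_div_factorial (x := n) (by positivity) hn
  have : 0 ≤ 1 - p := sub_nonneg.mpr hp1
  have hnk : 0 < n - k := Nat.sub_pos_of_lt hkn
  have htwopi : 0 ≤ 2 * π := by positivity
  refine le_of_mul_le_mul_right ?_ (show 0 < exp n / (exp 1 * √n) by positivity)
  calc binomialMass p n k * (exp n / (exp 1 * √n))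
      ≤ binomialMass p n k * (n ^ n / n !) :=
        mul_le_mul_of_nonneg_left hden (binomialMass_nonneg hp0 hp1 n k)
    _ = (n * p) ^ k / k ! * ((n * (1 - p)) ^ (n - k) / (n - k)!) :=
        binomialMass_mul_pow_div_factorial p hkn.le
    _ ≤ exp (n * p) / √(2 * π * k) * (exp (n * (1 - p)) / √(2 * π * (n - k : ℕ))) :=
        mul_le_mul (pow_div_factorial_le (by positivity) hk0)
          (pow_div_factorial_le (by positivity) hnk) (by positivity) (by positivity)
    _ = exp 1 / (2 * π) * (√n / (√k * √(n - k : ℕ))) * (exp n / (exp 1 * √n)) := by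
        rw [sqrt_mul htwopi, sqrt_mul htwopi, div_mul_div_comm, ← exp_add, mul_mul_mul_comm,
          mul_self_sqrt htwopi, ← mul_add, add_sub_cancel, mul_one]
        field_simp

lemma le_binomialMass_of_pos_of_lt (hp0 : 0 < p) (hp1 : p < 1) (hk0 : 0 < k) (hkn : k < n) :
    √(2 * π) / exp 2 * exp (-((k - n * p) ^ 2 / (n * p * (1 - p)))) *
      (√n / (√k * √(n - k : ℕ))) ≤ binomialMass p n k := by
  have hn : 0 < n := hk0.trans hkn
  have hq : 0 < 1 - p := sub_pos.mpr hp1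
  have hnk : 0 < n - k := Nat.sub_pos_of_lt hkn
  have hden : (n : ℝ) ^ n / n ! ≤ exp n / √(2 * π * n) := pow_div_factorial_le (by positivity) hn
  have hexp : n * p - (k - n * p) ^ 2 / (n * p) +
      (n * (1 - p) - ((n - k : ℕ) - n * (1 - p)) ^ 2 / (n * (1 - p))) =
      n + -((k - n * p) ^ 2 / (n * p * (1 - p))) := by
    rw [Nat.cast_sub hkn.le]
    field_simp
    ring
  have hexp2 : exp 2 = exp 1 * exp 1 := by rw [← exp_add, one_add_one_eq_two]
  refine le_of_mul_le_mul_right ?_ (show 0 < exp n / √(2 * π * n) by positivity)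
  calc √(2 * π) / exp 2 * exp (-((k - n * p) ^ 2 / (n * p * (1 - p)))) *
        (√n / (√k * √(n - k : ℕ))) * (exp n / √(2 * π * n))
      = exp (n * p - (k - n * p) ^ 2 / (n * p)) / (exp 1 * √k) *
          (exp (n * (1 - p) - ((n - k : ℕ) - n * (1 - p)) ^ 2 / (n * (1 - p))) /
            (exp 1 * √(n - k : ℕ))) := by
        rw [div_mul_div_comm (exp _), ← exp_add, hexp, exp_add, hexp2,
          sqrt_mul (show 0 ≤ 2 * π by positivity)]
        field_simp
    _ ≤ (n * p) ^ k / k ! * ((n * (1 - p)) ^ (n - k) / (n - k)!) :=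
        mul_le_mul (le_pow_div_factorial (by positivity) hk0)
          (le_pow_div_factorial (by positivity) hnk) (by positivity) (by positivity)
    _ = binomialMass p n k * (n ^ n / n !) := (binomialMass_mul_pow_div_factorial p hkn.le).symm
    _ ≤ binomialMass p n k * (exp n / √(2 * π * n)) :=
        mul_le_mul_of_nonneg_left hden (binomialMass_nonneg hp0.le hp1.le n k)

end LocalBounds

section UniformBounds

variable {p : ℝ} {n : ℕ}

lemma eventually_le_sqrt_natCast (x : ℝ) : ∀ᶠ n : ℕ in atTop, x ≤ √(n : ℝ) :=
  (tendsto_sqrt_atTop.comp tendsto_natCast_atTop_atTop).eventually_ge_atTop x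

lemma binomialMass_le_of_le_mul (hp0 : 0 ≤ p) (hp1 : p < 1) {k j : ℕ} (hkj : k ≤ j)
    (hj : (j : ℝ) ≤ n * p) : binomialMass p n k ≤ binomialMass p n j := by
  induction j, hkj using Nat.le_induction with
  | base => exact le_rfl
  | succ j _ ih =>
    have hq : 0 < 1 - p := sub_pos.mpr hp1
    rw [Nat.cast_add_one] at hj
    have hjn : j < n := by
      have : (n : ℝ) * p ≤ n := mul_le_of_le_one_right n.cast_nonneg hp1.le
      exact_mod_cast show (j : ℝ) < n by linarith
    have hratio : (1 - p) * (j + 1) ≤ p * (n - j) := by linarith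
    refine (ih (by linarith)).trans
      (le_of_mul_le_mul_right ?_ (show 0 < (1 - p) * (j + 1) by positivity))
    rw [binomialMass_succ p hjn]
    exact mul_le_mul_of_nonneg_left hratio (binomialMass_nonneg hp0 hp1.le n j)

lemma exists_binomialMass_le_of_le_mul (hp0 : 0 < p) (hp1 : p < 1) :
    ∃ C > 0, ∀ᶠ n : ℕ in atTop, ∀ k : ℕ, (k : ℝ) ≤ n * p → binomialMass p n k ≤ C / √n := by
  have hq : 0 < 1 - p := sub_pos.mpr hp1
  refine ⟨exp 1 / (2 * π) * (1 / √(p / 2 * (1 - p))), by positivity, ?_⟩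
  filter_upwards [tendsto_natCast_atTop_atTop.eventually_ge_atTop (2 / p),
    eventually_gt_atTop 0] with n hn hn0 k hk
  rw [div_le_iff₀ hp0] at hn
  set m := ⌊n * p⌋₊
  have hm_le : (m : ℝ) ≤ n * p := Nat.floor_le (by positivity)
  have hm_gt : n * p - 1 < m := Nat.sub_one_lt_floor _
  have hm_pos : 0 < m := by exact_mod_cast show (0 : ℝ) < m by linarith
  have hm_lt : m < n := by
    have : (n : ℝ) * p < n := mul_lt_of_lt_one_right (by positivity) hp1
    exact_mod_cast show (m : ℝ) < n by linarith
  have hvar : n * √(p / 2 * (1 - p)) ≤ √m * √(n - m : ℕ) := by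
    rw [← sqrt_mul m.cast_nonneg, Nat.cast_sub hm_lt.le]
    refine le_sqrt_of_sq_le ?_
    rw [mul_pow, sq_sqrt (by positivity)]
    calc (n : ℝ) ^ 2 * (p / 2 * (1 - p)) = n * p / 2 * (n * (1 - p)) := by ring
      _ ≤ m * (n - m) := by gcongr <;> linarith
  calc binomialMass p n k ≤ binomialMass p n m :=
        binomialMass_le_of_le_mul hp0.le hp1 (Nat.le_floor hk) hm_le
    _ ≤ exp 1 / (2 * π) * (√n / (√m * √(n - m : ℕ))) :=
        binomialMass_le_of_pos_of_lt hp0.le hp1.le hm_pos hm_lt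
    _ ≤ exp 1 / (2 * π) * (√n / (n * √(p / 2 * (1 - p)))) := by gcongr
    _ = exp 1 / (2 * π) * (1 / √(p / 2 * (1 - p))) / √n := by
        nth_rewrite 2 [← mul_self_sqrt n.cast_nonneg]
        field_simp

lemma exists_binomialMass_le (hp0 : 0 < p) (hp1 : p < 1) :
    ∃ C > 0, ∀ᶠ n : ℕ in atTop, ∀ k, binomialMass p n k ≤ C / √n := by
  obtain ⟨C₁, hC₁, h₁⟩ := exists_binomialMass_le_of_le_mul hp0 hp1
  obtain ⟨C₂, -, h₂⟩ :=
    exists_binomialMass_le_of_le_mul (sub_pos.mpr hp1) (sub_lt_self 1 hp0)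
  refine ⟨max C₁ C₂, lt_max_of_lt_left hC₁, ?_⟩
  filter_upwards [h₁, h₂] with n h₁ h₂ k
  rcases lt_or_ge n k with hnk | hkn
  · rw [binomialMass_eq_zero_of_lt p hnk]
    positivity
  rcases le_total (k : ℝ) (n * p) with hk | hk
  · exact (h₁ k hk).trans (by gcongr; exact le_max_left _ _)
  · rw [binomialMass_symm p hkn]
    refine (h₂ (n - k) ?_).trans (by gcongr; exact le_max_right _ _)
    rw [Nat.cast_sub hkn]
    linarith

lemma eventually_nonneg_of_abs_sub_le (hp0 : 0 < p) (A : ℝ) :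
    ∀ᶠ n : ℕ in atTop, ∀ y : ℝ, |y - n * p| ≤ A * √n → 0 ≤ y := by
  filter_upwards [eventually_le_sqrt_natCast (A / p)] with n hn y hy
  rw [div_le_iff₀ hp0] at hn
  have : A * √n ≤ n * p :=
    calc A * √n ≤ √n * p * √n := by gcongr
      _ = n * p := by rw [mul_right_comm, mul_self_sqrt n.cast_nonneg]
  linarith [(abs_le.mp hy).1]

lemma eventually_le_mul_sub_of_abs_sub_le {r : ℝ} (hr0 : 0 ≤ r) (hpr : p < r * (1 - p)) (A : ℝ) :
    ∀ᶠ n : ℕ in atTop, ∀ x : ℝ, |x - n * p| ≤ A * √n → x ≤ r * (n - x) := by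
  have hgap : 0 < r * (1 - p) - p := sub_pos.mpr hpr
  filter_upwards [eventually_le_sqrt_natCast ((1 + r) * A / (r * (1 - p) - p))] with n hn x hx
  rw [div_le_iff₀ hgap] at hn
  have hdev : (1 + r) * (x - n * p) ≤ n * (r * (1 - p) - p) :=
    calc (1 + r) * (x - n * p) ≤ (1 + r) * A * √n := by
          rw [mul_assoc]
          gcongr
          exact (abs_le.mp hx).2
      _ ≤ √n * (r * (1 - p) - p) * √n := by gcongr
      _ = n * (r * (1 - p) - p) := by rw [mul_right_comm, mul_self_sqrt n.cast_nonneg]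
  linarith

lemma eventually_pos_and_lt_of_abs_sub_le (hp0 : 0 < p) (hp1 : p < 1) (A : ℝ) :
    ∀ᶠ n : ℕ in atTop, ∀ k : ℕ, |k - n * p| ≤ A * √n → 0 < k ∧ k < n := by
  have hq : 0 < 1 - p := sub_pos.mpr hp1
  filter_upwards [eventually_le_sqrt_natCast ((A + 1) / p),
    eventually_le_sqrt_natCast ((A + 1) / (1 - p)), eventually_gt_atTop 0] with n hnp hnq hn k hk
  rw [div_le_iff₀ (by assumption)] at hnp hnq
  have hs : 0 < √(n : ℝ) := by positivity
  have hss : √(n : ℝ) * √n = n := mul_self_sqrt n.cast_nonneg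
  obtain ⟨hk_ge, hk_le⟩ := abs_le.mp hk
  constructor
  · exact_mod_cast show (0 : ℝ) < k by nlinarith
  · exact_mod_cast show (k : ℝ) < n by nlinarith

lemma exists_le_binomialMass_of_abs_sub_le (hp0 : 0 < p) (hp1 : p < 1) (A : ℝ) :
    ∃ c > 0, ∀ᶠ n : ℕ in atTop, ∀ k : ℕ, |k - n * p| ≤ A * √n →
      k ≤ n ∧ c / √n ≤ binomialMass p n k := by
  have hq : 0 < 1 - p := sub_pos.mpr hp1
  refine ⟨√(2 * π) / exp 2 * exp (-(A ^ 2 / (p * (1 - p)))), by positivity, ?_⟩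
  filter_upwards [eventually_pos_and_lt_of_abs_sub_le hp0 hp1 A] with n hrange k hk
  obtain ⟨hk0, hkn⟩ := hrange k hk
  have hn : 0 < n := hk0.trans hkn
  have hsq : (k - n * p) ^ 2 ≤ A ^ 2 * n := by
    rw [← sq_abs]
    calc |k - n * p| ^ 2 ≤ (A * √n) ^ 2 := by gcongr
      _ = A ^ 2 * n := by rw [mul_pow, sq_sqrt n.cast_nonneg]
  have hgeom : 1 / √n ≤ √n / (√k * √(n - k : ℕ)) := by
    have hnk : 0 < n - k := Nat.sub_pos_of_lt hkn
    rw [div_le_div_iff₀ (by positivity) (by positivity), one_mul]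
    gcongr
    exact Nat.sub_le n k
  refine ⟨hkn.le, ?_⟩
  calc √(2 * π) / exp 2 * exp (-(A ^ 2 / (p * (1 - p)))) / √n
      = √(2 * π) / exp 2 * exp (-(A ^ 2 * n / (n * p * (1 - p)))) * (1 / √n) := by
        rw [mul_one_div]
        congr 4
        field_simp
    _ ≤ √(2 * π) / exp 2 * exp (-((k - n * p) ^ 2 / (n * p * (1 - p)))) *
          (√n / (√k * √(n - k : ℕ))) := by gcongr
    _ ≤ binomialMass p n k := le_binomialMass_of_pos_of_lt hp0 hp1 hk0 hkn

end UniformBounds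

section Taylor

lemma abs_sub_sub_mul_le_of_abs_deriv_le {f f' f'' : ℝ → ℝ} {M v w : ℝ}
    (hf : ∀ x ∈ Set.uIcc w v, HasDerivAt f (f' x) x)
    (hf' : ∀ x ∈ Set.uIcc w v, HasDerivAt f' (f'' x) x)
    (hM : ∀ x ∈ Set.uIcc w v, |f'' x| ≤ M) :
    |f v - f w - (v - w) * f' w| ≤ M * (v - w) ^ 2 := by
  have hM0 : 0 ≤ M := (abs_nonneg _).trans (hM w Set.left_mem_uIcc)
  have hlip : ∀ x ∈ Set.uIcc w v, |f' x - f' w| ≤ M * |v - w| := fun x hx =>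
    calc |f' x - f' w| ≤ M * |x - w| :=
          (convex_uIcc w v).norm_image_sub_le_of_norm_hasDerivWithin_le
            (fun y hy => (hf' y hy).hasDerivWithinAt) hM Set.left_mem_uIcc hx
      _ ≤ M * |v - w| := by gcongr M * ?_; exact Set.abs_sub_left_of_mem_uIcc hx
  have hremainder : ∀ x ∈ Set.uIcc w v,
      HasDerivAt (fun x => f x - x * f' w) (f' x - f' w) x := fun x hx => by
    simpa using (hf x hx).fun_sub ((hasDerivAt_id x).mul_const (f' w))
  calc |f v - f w - (v - w) * f' w| = |f v - v * f' w - (f w - w * f' w)| := by congr 1; ring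
    _ ≤ M * |v - w| * |v - w| :=
        (convex_uIcc w v).norm_image_sub_le_of_norm_hasDerivWithin_le
          (fun y hy => (hremainder y hy).hasDerivWithinAt) hlip Set.left_mem_uIcc Set.right_mem_uIcc
    _ = M * (v - w) ^ 2 := by rw [mul_assoc, ← sq, sq_abs]

end Taylor

section Gaussian

open MeasureTheory Set

lemma gaussianPDFReal_zero_one (x : ℝ) :
    gaussianPDFReal 0 1 x = (√(2 * π))⁻¹ * exp (-x ^ 2 / 2) := by
  simp [gaussianPDFReal]

lemma gaussianPDFReal_zero_one_pos (x : ℝ) : 0 < gaussianPDFReal 0 1 x :=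
  gaussianPDFReal_pos 0 1 x one_ne_zero

lemma gaussianPDFReal_zero_one_neg (x : ℝ) :
    gaussianPDFReal 0 1 (-x) = gaussianPDFReal 0 1 x := by
  simp [gaussianPDFReal_zero_one]

lemma hasDerivAt_gaussianPDFReal_zero_one (x : ℝ) :
    HasDerivAt (gaussianPDFReal 0 1) (-(x * gaussianPDFReal 0 1 x)) x := by
  rw [funext gaussianPDFReal_zero_one]
  refine ((((hasDerivAt_pow 2 x).fun_neg.div_const 2).exp).const_mul (√(2 * π))⁻¹).congr_deriv ?_
  simp only [Nat.cast_ofNat, Nat.add_one_sub_one, pow_one]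
  ring

lemma integrable_mul_gaussianPDFReal_zero_one :
    Integrable fun x : ℝ => x * gaussianPDFReal 0 1 x := by
  convert (integrable_mul_exp_neg_mul_sq (one_half_pos (α := ℝ))).const_mul (√(2 * π))⁻¹ using 2
    with x
  rw [gaussianPDFReal_zero_one, show -x ^ 2 / 2 = -(1 / 2) * x ^ 2 by ring]
  ring

lemma setIntegral_Ioi_mul_gaussianPDFReal_zero_one (a : ℝ) :
    ∫ t in Ioi a, t * gaussianPDFReal 0 1 t = gaussianPDFReal 0 1 a := by
  have hderiv : ∀ t, HasDerivAt (gaussianPDFReal 0 1) (-(t * gaussianPDFReal 0 1 t)) t :=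
    hasDerivAt_gaussianPDFReal_zero_one
  have hint := integrable_mul_gaussianPDFReal_zero_one.neg.integrableOn (s := Ioi a)
  have hlim : Tendsto (gaussianPDFReal 0 1) atTop (𝓝 0) :=
    tendsto_zero_of_hasDerivAt_of_integrableOn_Ioi (fun t _ => hderiv t) hint
      (integrable_gaussianPDFReal 0 1).integrableOn
  simpa [integral_neg] using
    integral_Ioi_of_hasDerivAt_of_tendsto' (fun t _ => hderiv t) hint hlim

lemma gaussianQ_nonneg (x : ℝ) : 0 ≤ gaussianQ x := measureReal_nonneg

lemma gaussianQ_le_one (x : ℝ) : gaussianQ x ≤ 1 := measureReal_le_one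

lemma gaussianQ_neg (x : ℝ) : gaussianQ (-x) = 1 - gaussianQ x := by
  have hneg : (gaussianReal 0 1).map Neg.neg = gaussianReal 0 1 := by
    simpa using gaussianReal_map_neg (μ := 0) (v := 1)
  have := nullSingletonClass_gaussianReal (μ := 0) (v := 1) one_ne_zero
  calc gaussianQ (-x) = ((gaussianReal 0 1).map Neg.neg).real (Ioi (-x)) := by rw [hneg, gaussianQ]
    _ = (gaussianReal 0 1).real (Iio x) := by
        rw [map_measureReal_apply measurable_neg measurableSet_Ioi]
        simp
    _ = (gaussianReal 0 1).real (Iic x) := measureReal_congr Iio_ae_eq_Iic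
    _ = 1 - gaussianQ x := by
        rw [gaussianQ, ← compl_Iic, probReal_compl_eq_one_sub measurableSet_Iic, sub_sub_cancel]

lemma gaussianQ_eq_setIntegral (x : ℝ) : gaussianQ x = ∫ t in Ioi x, gaussianPDFReal 0 1 t := by
  rw [gaussianQ, Measure.real, gaussianReal_apply_eq_integral 0 one_ne_zero,
    ENNReal.toReal_ofReal]
  exact setIntegral_nonneg measurableSet_Ioi fun t _ => gaussianPDFReal_nonneg 0 1 t

lemma hasDerivAt_gaussianQ (x : ℝ) : HasDerivAt gaussianQ (-gaussianPDFReal 0 1 x) x := by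
  have hint := integrable_gaussianPDFReal 0 1
  have hcont : Continuous (gaussianPDFReal 0 1) :=
    continuous_iff_continuousAt.mpr fun t => (hasDerivAt_gaussianPDFReal_zero_one t).continuousAt
  have hQ : gaussianQ = fun y => gaussianQ 0 - ∫ t in (0 : ℝ)..y, gaussianPDFReal 0 1 t := by
    funext y
    rw [gaussianQ_eq_setIntegral, gaussianQ_eq_setIntegral,
      ← intervalIntegral.integral_Ioi_sub_Ioi' hint.integrableOn hint.integrableOn, sub_sub_cancel]
  rw [hQ]
  exact (hcont.integral_hasStrictDerivAt 0 x).hasDerivAt.const_sub _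

lemma mul_gaussianQ_le (x : ℝ) : x * gaussianQ x ≤ gaussianPDFReal 0 1 x := by
  rw [gaussianQ_eq_setIntegral, ← integral_const_mul,
    ← setIntegral_Ioi_mul_gaussianPDFReal_zero_one]
  exact setIntegral_mono_on ((integrable_gaussianPDFReal 0 1).const_mul x).integrableOn
    integrable_mul_gaussianPDFReal_zero_one.integrableOn measurableSet_Ioi
    fun t ht => mul_le_mul_of_nonneg_right (le_of_lt ht) (gaussianPDFReal_nonneg 0 1 t)

/-- The Mills ratio of the standard Gaussian distribution: the ratio of its tail to its density. -/
noncomputable def millsRatio (x : ℝ) : ℝ := gaussianQ x / gaussianPDFReal 0 1 x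

lemma millsRatio_nonneg (x : ℝ) : 0 ≤ millsRatio x :=
  div_nonneg (gaussianQ_nonneg x) (gaussianPDFReal_nonneg 0 1 x)

lemma mul_millsRatio_le_one (x : ℝ) : x * millsRatio x ≤ 1 := by
  rw [millsRatio, ← mul_div_assoc, div_le_one (gaussianPDFReal_zero_one_pos x)]
  exact mul_gaussianQ_le x

lemma hasDerivAt_millsRatio (x : ℝ) : HasDerivAt millsRatio (x * millsRatio x - 1) x := by
  have hx := (gaussianPDFReal_zero_one_pos x).ne'
  refine ((hasDerivAt_gaussianQ x).div (hasDerivAt_gaussianPDFReal_zero_one x) hx).congr_deriv ?_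
  rw [millsRatio]
  field_simp
  ring

lemma hasDerivAt_mul_millsRatio_sub_one (x : ℝ) :
    HasDerivAt (fun x => x * millsRatio x - 1) (millsRatio x + x * (x * millsRatio x - 1)) x := by
  simpa using ((hasDerivAt_id x).mul (hasDerivAt_millsRatio x)).sub_const 1

lemma millsRatio_antitone : Antitone millsRatio :=
  antitone_of_hasDerivAt_nonpos hasDerivAt_millsRatio fun x =>
    sub_nonpos.mpr (mul_millsRatio_le_one x)

/-- A constant for the half-line `[a, ∞)`: it bounds the derivative `x * millsRatio x - 1` of the
Mills ratio there, and `1 + |x|` times it bounds the second derivative. -/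
noncomputable def millsBound (a : ℝ) : ℝ := 1 + millsRatio a + |a| * millsRatio a

lemma millsBound_nonneg (a : ℝ) : 0 ≤ millsBound a := by
  have := millsRatio_nonneg a
  unfold millsBound
  positivity

lemma abs_mul_millsRatio_sub_one_le {a x : ℝ} (hax : a ≤ x) :
    |x * millsRatio x - 1| ≤ millsBound a := by
  have hneg : -x * millsRatio x ≤ |a| * millsRatio a := by
    rcases le_total 0 x with hx | _
    · exact (mul_nonpos_of_nonpos_of_nonneg (neg_nonpos.mpr hx) (millsRatio_nonneg x)).trans
        (mul_nonneg (abs_nonneg a) (millsRatio_nonneg a))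
    · exact mul_le_mul ((neg_le_neg hax).trans (neg_le_abs a)) (millsRatio_antitone hax)
        (millsRatio_nonneg x) (abs_nonneg a)
  rw [abs_of_nonpos (sub_nonpos.mpr (mul_millsRatio_le_one x)), millsBound]
  linarith [millsRatio_nonneg a]

lemma abs_millsRatio_add_mul_le {a x : ℝ} (hax : a ≤ x) :
    |millsRatio x + x * (x * millsRatio x - 1)| ≤ millsBound a * (1 + |x|) := by
  have hm : |millsRatio x| ≤ millsBound a := by
    rw [abs_of_nonneg (millsRatio_nonneg x), millsBound]
    have := mul_nonneg (abs_nonneg a) (millsRatio_nonneg a)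
    linarith [millsRatio_antitone hax]
  calc |millsRatio x + x * (x * millsRatio x - 1)|
      ≤ |millsRatio x| + |x| * |x * millsRatio x - 1| := by
        rw [← abs_mul]
        exact abs_add_le _ _
    _ ≤ millsBound a + |x| * millsBound a := by
        gcongr
        exact abs_mul_millsRatio_sub_one_le hax
    _ = millsBound a * (1 + |x|) := by ring

lemma abs_millsRatio_sub_le {a v w : ℝ} (hv : a ≤ v) (hw : a ≤ w) :
    |millsRatio v - millsRatio w| ≤ millsBound a * |v - w| :=
  (convex_Ici a).norm_image_sub_le_of_norm_hasDerivWithin_le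
    (fun x _ => (hasDerivAt_millsRatio x).hasDerivWithinAt)
    (fun _ hx => abs_mul_millsRatio_sub_one_le hx) hw hv

lemma abs_millsRatio_sub_sub_mul_le {a v w : ℝ} (hv : a ≤ v) (hw : a ≤ w) (hvw : |v - w| ≤ 1) :
    |millsRatio v - millsRatio w - (v - w) * (w * millsRatio w - 1)| ≤
      2 * millsBound a * (1 + |w|) * (v - w) ^ 2 := by
  refine abs_sub_sub_mul_le_of_abs_deriv_le (fun x _ => hasDerivAt_millsRatio x)
    (fun x _ => hasDerivAt_mul_millsRatio_sub_one x) fun x hx => ?_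
  have hx_abs : |x| ≤ 1 + |w| := by
    have := (abs_sub_abs_le_abs_sub x w).trans ((abs_sub_left_of_mem_uIcc hx).trans hvw)
    linarith
  calc |millsRatio x + x * (x * millsRatio x - 1)| ≤ millsBound a * (1 + |x|) :=
        abs_millsRatio_add_mul_le ((le_min hw hv).trans hx.1)
    _ ≤ millsBound a * (2 * (1 + |w|)) := by
        gcongr
        · exact millsBound_nonneg a
        · linarith [abs_nonneg w]
    _ = 2 * millsBound a * (1 + |w|) := by ring

end Gaussian

section SteinSolution

/-- The bounded solution `f` of the Stein equation `f' w - w * f w = 1_{w ≤ z} - (1 - Q z)`, the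
indicator being that of `(-∞, z]` and `1 - Q z` its Gaussian expectation. -/
noncomputable def steinSolution (z w : ℝ) : ℝ :=
  if w ≤ z then gaussianQ z * millsRatio (-w) else (1 - gaussianQ z) * millsRatio w

/-- The derivative of `steinSolution z` as prescribed by the Stein equation; at the kink `w = z` it
is the left derivative. -/
noncomputable def steinDeriv (z w : ℝ) : ℝ :=
  w * steinSolution z w + (if w ≤ z then 1 else 0) - (1 - gaussianQ z)

variable {z v w : ℝ}

lemma steinSolution_of_le (h : w ≤ z) :
    steinSolution z w = gaussianQ z * millsRatio (-w) := if_pos h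

lemma steinSolution_of_ge (h : z ≤ w) :
    steinSolution z w = (1 - gaussianQ z) * millsRatio w := by
  rcases h.eq_or_lt with rfl | h
  · rw [steinSolution_of_le le_rfl, millsRatio, millsRatio, gaussianQ_neg,
      gaussianPDFReal_zero_one_neg]
    ring
  · exact if_neg h.not_ge

lemma steinDeriv_of_le (h : w ≤ z) :
    steinDeriv z w = gaussianQ z * -(-w * millsRatio (-w) - 1) := by
  rw [steinDeriv, steinSolution_of_le h, if_pos h]
  ring

lemma steinDeriv_of_lt (h : z < w) :
    steinDeriv z w = (1 - gaussianQ z) * (w * millsRatio w - 1) := by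
  rw [steinDeriv, steinSolution_of_ge h.le, if_neg h.not_ge]
  ring

lemma abs_gaussianQ_mul_le {x y : ℝ} (z : ℝ) (h : |x| ≤ y) : |gaussianQ z * x| ≤ y := by
  rw [abs_mul, abs_of_nonneg (gaussianQ_nonneg z)]
  exact (mul_le_of_le_one_left (abs_nonneg x) (gaussianQ_le_one z)).trans h

lemma abs_one_sub_gaussianQ_mul_le {x y : ℝ} (z : ℝ) (h : |x| ≤ y) :
    |(1 - gaussianQ z) * x| ≤ y := by
  rw [← gaussianQ_neg]
  exact abs_gaussianQ_mul_le (-z) h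

lemma abs_steinDeriv_le (z w : ℝ) : |steinDeriv z w| ≤ millsBound (-|z|) := by
  rcases le_or_gt w z with h | h
  · rw [steinDeriv_of_le h]
    refine abs_gaussianQ_mul_le z ?_
    rw [abs_neg]
    exact abs_mul_millsRatio_sub_one_le (neg_le_neg (h.trans (le_abs_self z)))
  · rw [steinDeriv_of_lt h]
    exact abs_one_sub_gaussianQ_mul_le z
      (abs_mul_millsRatio_sub_one_le ((neg_abs_le z).trans h.le))

lemma abs_steinSolution_sub_le_of_le (hv : v ≤ z) (hw : w ≤ z) :
    |steinSolution z v - steinSolution z w| ≤ millsBound (-|z|) * |v - w| := by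
  rw [steinSolution_of_le hv, steinSolution_of_le hw, ← mul_sub, abs_sub_comm v w,
    ← neg_sub_neg v w]
  exact abs_gaussianQ_mul_le z (abs_millsRatio_sub_le (neg_le_neg (hv.trans (le_abs_self z)))
    (neg_le_neg (hw.trans (le_abs_self z))))

lemma abs_steinSolution_sub_le_of_ge (hv : z ≤ v) (hw : z ≤ w) :
    |steinSolution z v - steinSolution z w| ≤ millsBound (-|z|) * |v - w| := by
  rw [steinSolution_of_ge hv, steinSolution_of_ge hw, ← mul_sub]
  exact abs_one_sub_gaussianQ_mul_le z
    (abs_millsRatio_sub_le ((neg_abs_le z).trans hv) ((neg_abs_le z).trans hw))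

lemma abs_steinSolution_taylor_le_of_le (hv : v ≤ z) (hw : w ≤ z) (hvw : |v - w| ≤ 1) :
    |steinSolution z v - steinSolution z w - (v - w) * steinDeriv z w| ≤
      2 * millsBound (-|z|) * (1 + |w|) * (v - w) ^ 2 := by
  rw [abs_sub_comm, ← neg_sub_neg] at hvw
  have htaylor := abs_millsRatio_sub_sub_mul_le (neg_le_neg (hv.trans (le_abs_self z)))
    (neg_le_neg (hw.trans (le_abs_self z))) hvw
  rw [abs_neg, neg_sub_neg, sub_sq_comm] at htaylor
  rw [steinSolution_of_le hv, steinSolution_of_le hw, steinDeriv_of_le hw]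
  convert abs_gaussianQ_mul_le z htaylor using 2
  ring

lemma abs_steinSolution_taylor_le_of_lt (hv : z ≤ v) (hw : z < w) (hvw : |v - w| ≤ 1) :
    |steinSolution z v - steinSolution z w - (v - w) * steinDeriv z w| ≤
      2 * millsBound (-|z|) * (1 + |w|) * (v - w) ^ 2 := by
  rw [steinSolution_of_ge hv, steinSolution_of_ge hw.le, steinDeriv_of_lt hw]
  convert abs_one_sub_gaussianQ_mul_le z (abs_millsRatio_sub_sub_mul_le ((neg_abs_le z).trans hv)
    ((neg_abs_le z).trans hw.le) hvw) using 2
  ring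

lemma abs_steinSolution_taylor_le_of_crossing (hw : w ≤ z) (hv : z ≤ v) :
    |steinSolution z v - steinSolution z w - (v - w) * steinDeriv z w| ≤
      2 * millsBound (-|z|) * (v - w) := by
  have hright := abs_steinSolution_sub_le_of_ge hv (le_refl z)
  have hleft := abs_steinSolution_sub_le_of_le (le_refl z) hw
  rw [abs_of_nonneg (sub_nonneg.mpr hv)] at hright
  rw [abs_of_nonneg (sub_nonneg.mpr hw)] at hleft
  have hderiv : |(v - w) * steinDeriv z w| ≤ (v - w) * millsBound (-|z|) := by
    rw [abs_mul, abs_of_nonneg (sub_nonneg.mpr (hw.trans hv))]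
    exact mul_le_mul_of_nonneg_left (abs_steinDeriv_le z w) (sub_nonneg.mpr (hw.trans hv))
  calc |steinSolution z v - steinSolution z w - (v - w) * steinDeriv z w|
      = |(steinSolution z v - steinSolution z z) + (steinSolution z z - steinSolution z w) -
          (v - w) * steinDeriv z w| := by rw [sub_add_sub_cancel]
    _ ≤ |steinSolution z v - steinSolution z z| + |steinSolution z z - steinSolution z w| +
          |(v - w) * steinDeriv z w| := (abs_sub _ _).trans (add_le_add_left (abs_add_le _ _) _)
    _ ≤ 2 * millsBound (-|z|) * (v - w) := by linarith

/-- The remainder of the first order Taylor expansion of `steinSolution z` at `w` for an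
increment `d`. -/
noncomputable def steinRemainder (z w d : ℝ) : ℝ :=
  steinSolution z (w + d) - steinSolution z w - d * steinDeriv z w

lemma abs_steinRemainder_le {d : ℝ} (hd0 : 0 ≤ d) (hd1 : d ≤ 1) :
    |steinRemainder z w d| ≤ 2 * millsBound (-|z|) * (1 + |w|) * d ^ 2 +
      if w ≤ z ∧ z < w + d then 2 * millsBound (-|z|) * d else 0 := by
  have hbound := millsBound_nonneg (-|z|)
  have hd : |w + d - w| ≤ 1 := by rwa [add_sub_cancel_left, abs_of_nonneg hd0]
  rw [steinRemainder]
  split_ifs with hcross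
  · have := abs_steinSolution_taylor_le_of_crossing hcross.1 hcross.2.le
    rw [add_sub_cancel_left] at this
    exact this.trans (le_add_of_nonneg_left (by positivity))
  · rw [add_zero]
    rcases le_or_gt w z with hw | hw
    · have hv : w + d ≤ z := not_lt.mp fun hv => hcross ⟨hw, hv⟩
      simpa only [add_sub_cancel_left] using abs_steinSolution_taylor_le_of_le hv hw hd
    · have hv : z ≤ w + d := by linarith
      simpa only [add_sub_cancel_left] using abs_steinSolution_taylor_le_of_lt hv hw hd

end SteinSolution

section BerryEsseen

/-- The standard deviation of a binomial random variable with parameters `n`, `p`. -/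
noncomputable def binomialStdDev (p : ℝ) (n : ℕ) : ℝ := √(n * p * (1 - p))

/-- The value at `k` of the standardization of a binomial random variable with parameters
`n`, `p`. -/
noncomputable def binomialZScore (p : ℝ) (n k : ℕ) : ℝ := (k - n * p) / binomialStdDev p n

/-- The point which the normal approximation of a binomial random variable with parameters `n`, `p`
exceeds with probability `gaussianQ z`. -/
noncomputable def normalQuantile (p : ℝ) (n : ℕ) (z : ℝ) : ℝ := n * p + binomialStdDev p n * z

variable {p : ℝ} {n : ℕ}

lemma binomialStdDev_pos (hp0 : 0 < p) (hp1 : p < 1) (hn : 0 < n) : 0 < binomialStdDev p n := by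
  have : 0 < 1 - p := sub_pos.mpr hp1
  unfold binomialStdDev
  positivity

lemma binomialStdDev_sq (hp0 : 0 ≤ p) (hp1 : p ≤ 1) (n : ℕ) :
    binomialStdDev p n ^ 2 = n * p * (1 - p) := by
  have : 0 ≤ 1 - p := sub_nonneg.mpr hp1
  exact sq_sqrt (by positivity)

lemma binomialStdDev_eq_mul_sqrt (p : ℝ) (n : ℕ) :
    binomialStdDev p n = √(p * (1 - p)) * √n := by
  rw [binomialStdDev, mul_assoc, sqrt_mul n.cast_nonneg, mul_comm]

lemma binomialZScore_succ (p : ℝ) (n k : ℕ) :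
    binomialZScore p n (k + 1) = binomialZScore p n k + 1 / binomialStdDev p n := by
  rw [binomialZScore, binomialZScore, Nat.cast_add_one]
  ring

lemma binomialZScore_mono (p : ℝ) (n : ℕ) : Monotone (binomialZScore p n) := fun i j hij => by
  have : (i : ℝ) ≤ j := Nat.cast_le.mpr hij
  unfold binomialZScore
  gcongr
  exact sqrt_nonneg _

lemma binomialZScore_le_iff (hσ : 0 < binomialStdDev p n) {z : ℝ} {k : ℕ} :
    binomialZScore p n k ≤ z ↔ k ≤ normalQuantile p n z := by
  rw [binomialZScore, normalQuantile, div_le_iff₀' hσ, sub_le_iff_le_add']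

lemma sum_binomialMass_mul_binomialZScore_sq (hp0 : 0 < p) (hp1 : p < 1) (hn : 0 < n) :
    ∑ k ∈ range (n + 1), binomialMass p n k * binomialZScore p n k ^ 2 = 1 := by
  have hσ := binomialStdDev_pos hp0 hp1 hn
  simp only [binomialZScore, div_pow, mul_div_assoc', ← sum_div]
  rw [sum_binomialMass_mul_centered_sq, ← binomialStdDev_sq hp0.le hp1.le, div_self (by positivity)]

lemma sum_binomialMass_mul_abs_binomialZScore_le (hp0 : 0 < p) (hp1 : p < 1) (hn : 0 < n) :
    ∑ k ∈ range (n + 1), binomialMass p n k * |binomialZScore p n k| ≤ 1 :=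
  calc ∑ k ∈ range (n + 1), binomialMass p n k * |binomialZScore p n k|
      ≤ ∑ k ∈ range (n + 1),
          (binomialMass p n k + binomialMass p n k * binomialZScore p n k ^ 2) / 2 := by
        refine sum_le_sum fun k _ => ?_
        have hsq := mul_nonneg (binomialMass_nonneg hp0.le hp1.le n k)
          (sq_nonneg (1 - |binomialZScore p n k|))
        rw [sub_sq, sq_abs] at hsq
        linarith
    _ = 1 := by
        rw [← sum_div, sum_add_distrib, sum_binomialMass,
          sum_binomialMass_mul_binomialZScore_sq hp0 hp1 hn]
        norm_num

lemma sum_binomialMass_mul_binomialZScore_mul (p : ℝ) (n : ℕ) (f : ℝ → ℝ) :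
    ∑ k ∈ range (n + 1), binomialMass p n k * (binomialZScore p n k * f (binomialZScore p n k)) =
      ∑ k ∈ range (n + 1), binomialMass p n k * (p * (n - k) / binomialStdDev p n *
        (f (binomialZScore p n k + 1 / binomialStdDev p n) - f (binomialZScore p n k))) := by
  have hstein := sum_binomialMass_mul_sub p n fun k =>
    f (binomialZScore p n k) / binomialStdDev p n
  simp only [binomialZScore_succ] at hstein
  calc ∑ k ∈ range (n + 1), binomialMass p n k * (binomialZScore p n k * f (binomialZScore p n k))
      = ∑ k ∈ range (n + 1), binomialMass p n k *
          ((k - n * p) * (f (binomialZScore p n k) / binomialStdDev p n)) :=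
        sum_congr rfl fun k _ => by nth_rewrite 1 [binomialZScore]; ring
    _ = _ := hstein.trans (sum_congr rfl fun k _ => by ring)

lemma gaussianQ_sub_binomialTail (hσ : 0 < binomialStdDev p n) (z : ℝ) :
    gaussianQ z - binomialTail p n (normalQuantile p n z) =
      ∑ k ∈ range (n + 1), binomialMass p n k * (steinDeriv z (binomialZScore p n k) -
        binomialZScore p n k * steinSolution z (binomialZScore p n k)) := by
  rw [← one_mul (gaussianQ z), ← sum_binomialMass p n, sum_mul, binomialTail, sum_filter,
    ← sum_sub_distrib]
  refine sum_congr rfl fun k _ => ?_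
  simp only [steinDeriv, binomialZScore_le_iff hσ, ← not_lt]
  split_ifs <;> ring

lemma gaussianQ_sub_binomialTail_eq_sum_steinRemainder (hp0 : 0 < p) (hp1 : p < 1) (hn : 0 < n)
    (z : ℝ) :
    gaussianQ z - binomialTail p n (normalQuantile p n z) =
      ∑ k ∈ range (n + 1), binomialMass p n k *
        (p * binomialZScore p n k / binomialStdDev p n * steinDeriv z (binomialZScore p n k) -
          p * (n - k) / binomialStdDev p n *
            steinRemainder z (binomialZScore p n k) (1 / binomialStdDev p n)) := by
  have hσ := binomialStdDev_pos hp0 hp1 hn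
  rw [gaussianQ_sub_binomialTail hσ]
  simp only [mul_sub (binomialMass _ _ _), sum_sub_distrib]
  rw [sum_binomialMass_mul_binomialZScore_mul, ← sum_sub_distrib, ← sum_sub_distrib]
  refine sum_congr rfl fun k _ => ?_
  have hvar : p * binomialZScore p n k / binomialStdDev p n +
      p * (n - k) / binomialStdDev p n * (1 / binomialStdDev p n) = 1 := by
    rw [binomialZScore]
    field_simp
    rw [binomialStdDev_sq hp0.le hp1.le]
    ring
  rw [steinRemainder]
  linear_combination
    (-binomialMass p n k * steinDeriv z (binomialZScore p n k)) * hvar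

lemma sum_binomialMass_crossing_le (hp0 : 0 ≤ p) (hp1 : p ≤ 1) {M : ℝ}
    (hM : ∀ k, binomialMass p n k ≤ M) (z : ℝ) :
    ∑ k ∈ range (n + 1) with binomialZScore p n k ≤ z ∧
      z < binomialZScore p n k + 1 / binomialStdDev p n, binomialMass p n k ≤ M := by
  have hM0 : 0 ≤ M := (binomialMass_nonneg hp0 hp1 n 0).trans (hM 0)
  have hle : ∀ i j, z < binomialZScore p n i + 1 / binomialStdDev p n →
      binomialZScore p n j ≤ z → j ≤ i := fun i j hi hj => by
    rw [← binomialZScore_succ] at hi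
    exact Nat.lt_succ_iff.mp ((binomialZScore_mono p n).reflect_lt (hj.trans_lt hi))
  refine (sum_le_card_nsmul _ _ M fun k _ => hM k).trans ?_
  rw [nsmul_eq_mul]
  refine mul_le_of_le_one_left hM0 (Nat.cast_le_one.mpr (card_le_one.mpr fun i hi j hj => ?_))
  rw [mem_filter] at hi hj
  exact (hle j i hj.2.2 hi.2.1).antisymm (hle i j hi.2.2 hj.2.1)

lemma abs_sub_steinRemainder_le (hp0 : 0 < p) (hp1 : p < 1) (hσ : 1 ≤ binomialStdDev p n) {k : ℕ}
    (hk : k ≤ n) (z w : ℝ) :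
    |p * w / binomialStdDev p n * steinDeriv z w -
        p * (n - k) / binomialStdDev p n * steinRemainder z w (1 / binomialStdDev p n)| ≤
      millsBound (-|z|) / (1 - p) * ((2 + 3 * |w|) / binomialStdDev p n +
        2 * if w ≤ z ∧ z < w + 1 / binomialStdDev p n then 1 else 0) := by
  have hq : 0 < 1 - p := sub_pos.mpr hp1
  have hvar := binomialStdDev_sq hp0.le hp1.le n
  set σ := binomialStdDev p n
  have hσ0 : 0 < σ := one_pos.trans_le hσ
  have hK := millsBound_nonneg (-|z|)
  set K := millsBound (-|z|)
  have hcoef : 0 ≤ p * ((n : ℝ) - k) / σ :=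
    div_nonneg (mul_nonneg hp0.le (sub_nonneg.mpr (Nat.cast_le.mpr hk))) hσ0.le
  have hcoef_le : p * ((n : ℝ) - k) / σ ≤ σ / (1 - p) := by
    rw [div_le_div_iff₀ hσ0 hq, ← sq, hvar]
    have : 0 ≤ p * k * (1 - p) := by positivity
    linarith
  have hdrift : |p * w / σ * steinDeriv z w| ≤ K / (1 - p) * (|w| / σ) := by
    rw [abs_mul, abs_div, abs_mul, abs_of_pos hp0, abs_of_pos hσ0]
    calc p * |w| / σ * |steinDeriv z w| ≤ 1 * |w| / σ * K := by
          gcongr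
          exact abs_steinDeriv_le z w
      _ = K / 1 * (|w| / σ) := by ring
      _ ≤ K / (1 - p) * (|w| / σ) := by gcongr; linarith
  have hremainder : |p * (n - k) / σ * steinRemainder z w (1 / σ)| ≤ K / (1 - p) *
      (2 * (1 + |w|) / σ + 2 * if w ≤ z ∧ z < w + 1 / σ then 1 else 0) := by
    rw [abs_mul, abs_of_nonneg hcoef]
    calc p * (n - k) / σ * |steinRemainder z w (1 / σ)|
        ≤ σ / (1 - p) * (2 * K * (1 + |w|) * (1 / σ) ^ 2 +
            if w ≤ z ∧ z < w + 1 / σ then 2 * K * (1 / σ) else 0) :=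
          mul_le_mul hcoef_le (abs_steinRemainder_le (by positivity) ((div_le_one hσ0).mpr hσ))
            (abs_nonneg _) (by positivity)
      _ = _ := by
          split_ifs
          · field_simp
          · field_simp
            ring
  refine (abs_sub _ _).trans ((add_le_add hdrift hremainder).trans_eq ?_)
  ring

lemma abs_binomialTail_sub_gaussianQ_le (hp0 : 0 < p) (hp1 : p < 1)
    (hσ : 1 ≤ binomialStdDev p n) {M : ℝ} (hM : ∀ k, binomialMass p n k ≤ M) (z : ℝ) :
    |binomialTail p n (normalQuantile p n z) - gaussianQ z| ≤
      millsBound (-|z|) / (1 - p) * (5 / binomialStdDev p n + 2 * M) := by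
  have : 0 < 1 - p := sub_pos.mpr hp1
  have hσ0 : 0 < binomialStdDev p n := one_pos.trans_le hσ
  have hn : 0 < n := Nat.pos_of_ne_zero fun h => by simp [binomialStdDev, h] at hσ0
  have hK := millsBound_nonneg (-|z|)
  have habs := sum_binomialMass_mul_abs_binomialZScore_le hp0 hp1 hn
  have hcross := sum_binomialMass_crossing_le (n := n) hp0.le hp1.le hM z
  rw [abs_sub_comm, gaussianQ_sub_binomialTail_eq_sum_steinRemainder hp0 hp1 hn]
  calc _ ≤ ∑ k ∈ range (n + 1), binomialMass p n k * (millsBound (-|z|) / (1 - p) *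
        ((2 + 3 * |binomialZScore p n k|) / binomialStdDev p n + 2 *
          if binomialZScore p n k ≤ z ∧ z < binomialZScore p n k + 1 / binomialStdDev p n
          then 1 else 0)) := by
        refine (abs_sum_le_sum_abs _ _).trans (sum_le_sum fun k hk => ?_)
        rw [abs_mul, abs_of_nonneg (binomialMass_nonneg hp0.le hp1.le n k)]
        gcongr
        · exact binomialMass_nonneg hp0.le hp1.le n k
        · exact abs_sub_steinRemainder_le hp0 hp1 hσ (Nat.lt_succ_iff.mp (mem_range.mp hk)) z _
    _ = millsBound (-|z|) / (1 - p) *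
          ((2 * ∑ k ∈ range (n + 1), binomialMass p n k +
            3 * ∑ k ∈ range (n + 1), binomialMass p n k * |binomialZScore p n k|) /
              binomialStdDev p n +
            2 * ∑ k ∈ range (n + 1) with binomialZScore p n k ≤ z ∧
              z < binomialZScore p n k + 1 / binomialStdDev p n, binomialMass p n k) := by
        rw [sum_filter]
        simp only [mul_sum, sum_div, ← sum_add_distrib]
        refine sum_congr rfl fun k _ => ?_
        split_ifs <;> ring
    _ ≤ millsBound (-|z|) / (1 - p) * ((2 * 1 + 3 * 1) / binomialStdDev p n + 2 * M) := by
        rw [sum_binomialMass]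
        gcongr
    _ = _ := by norm_num

lemma exists_abs_binomialTail_sub_gaussianQ_le (hp0 : 0 < p) (hp1 : p < 1) (z : ℝ) :
    ∃ C, ∀ᶠ n : ℕ in atTop,
      |binomialTail p n (normalQuantile p n z) - gaussianQ z| ≤ C / √n := by
  obtain ⟨M, -, hM⟩ := exists_binomialMass_le hp0 hp1
  have hτ : 0 < √(p * (1 - p)) := sqrt_pos.mpr (mul_pos hp0 (sub_pos.mpr hp1))
  refine ⟨millsBound (-|z|) / (1 - p) * (5 / √(p * (1 - p)) + 2 * M), ?_⟩
  filter_upwards [hM, eventually_le_sqrt_natCast (1 / √(p * (1 - p)))] with n hM hn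
  have hσ : 1 ≤ binomialStdDev p n := by
    rwa [binomialStdDev_eq_mul_sqrt, ← div_le_iff₀' hτ]
  refine (abs_binomialTail_sub_gaussianQ_le hp0 hp1 hσ hM z).trans_eq ?_
  rw [binomialStdDev_eq_mul_sqrt]
  field_simp

end BerryEsseen

section TailShift

variable {p : ℝ} {n : ℕ}

lemma binomialTail_add_nsmul_le (hp0 : 0 ≤ p) (hp1 : p ≤ 1) {y c : ℝ} (hy : 0 ≤ y) {B : ℕ}
    (hc : ∀ k : ℕ, y < k → k ≤ y + B → k ≤ n ∧ c ≤ binomialMass p n k) :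
    binomialTail p n (y + B) + B • c ≤ binomialTail p n y := by
  have hmem : ∀ k ∈ Ioc ⌊y⌋₊ (⌊y⌋₊ + B), y < k ∧ k ≤ y + B := fun k hk => by
    rw [mem_Ioc] at hk
    have hle : (k : ℝ) ≤ ⌊y⌋₊ + B := by exact_mod_cast hk.2
    exact ⟨Nat.lt_of_floor_lt hk.1, hle.trans (add_le_add_left (Nat.floor_le hy) _)⟩
  have hdisj : Disjoint {k ∈ range (n + 1) | y + B < (k : ℕ)} (Ioc ⌊y⌋₊ (⌊y⌋₊ + B)) :=
    disjoint_left.mpr fun k hk hk' => (mem_filter.mp hk).2.not_ge (hmem k hk').2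
  have hsub : {k ∈ range (n + 1) | y + B < (k : ℕ)} ∪ Ioc ⌊y⌋₊ (⌊y⌋₊ + B) ⊆
      {k ∈ range (n + 1) | y < (k : ℕ)} := by
    refine union_subset (monotone_filter_right _ fun k _ hk => ?_) fun k hk => ?_
    · exact (le_add_of_nonneg_right B.cast_nonneg).trans_lt hk
    · obtain ⟨hyk, hkB⟩ := hmem k hk
      exact mem_filter.mpr ⟨mem_range.mpr (Nat.lt_succ_of_le (hc k hyk hkB).1), hyk⟩
  calc binomialTail p n (y + B) + B • c
      ≤ binomialTail p n (y + B) + ∑ k ∈ Ioc ⌊y⌋₊ (⌊y⌋₊ + B), binomialMass p n k := by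
        gcongr
        simpa using card_nsmul_le_sum (Ioc ⌊y⌋₊ (⌊y⌋₊ + B)) (binomialMass p n) c fun k hk =>
          (hc k (hmem k hk).1 (hmem k hk).2).2
    _ ≤ binomialTail p n y := by
        rw [binomialTail, ← sum_union hdisj]
        exact sum_le_sum_of_subset_of_nonneg hsub fun k _ _ => binomialMass_nonneg hp0 hp1 n k

lemma exists_binomialTail_add_le (hp0 : 0 < p) (hp1 : p < 1) (A D : ℝ) :
    ∃ B : ℕ, ∀ᶠ n : ℕ in atTop, ∀ y : ℝ, |y - n * p| ≤ A * √n →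
      binomialTail p n (y + B) + D / √n ≤ binomialTail p n y := by
  obtain ⟨c, hc0, hc⟩ := exists_le_binomialMass_of_abs_sub_le hp0 hp1 (A + 1)
  refine ⟨⌈D / c⌉₊, ?_⟩
  filter_upwards [hc, eventually_nonneg_of_abs_sub_le hp0 A, eventually_le_sqrt_natCast ⌈D / c⌉₊]
    with n hc hnonneg hB y hy
  obtain ⟨hy_ge, hy_le⟩ := abs_le.mp hy
  have hmass : D / √n ≤ ⌈D / c⌉₊ • (c / √n) := by
    rw [nsmul_eq_mul, mul_div_assoc']
    gcongr
    exact (div_le_iff₀ hc0).mp (Nat.le_ceil _)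
  have hshift := binomialTail_add_nsmul_le hp0.le hp1.le (hnonneg y hy) (B := ⌈D / c⌉₊)
    fun k hyk hkB => hc k (abs_le.mpr ⟨by linarith [sqrt_nonneg (n : ℝ)], by linarith⟩)
  linarith

lemma abs_normalQuantile_sub_le (hp0 : 0 < p) (hp1 : p < 1) (n : ℕ) (z : ℝ) :
    |normalQuantile p n z - n * p| ≤ |z| * √n := by
  have hτ : √(p * (1 - p)) ≤ 1 := sqrt_le_one.mpr (by nlinarith)
  rw [normalQuantile, add_sub_cancel_left, binomialStdDev_eq_mul_sqrt, abs_mul,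
    abs_of_nonneg (by positivity), mul_comm]
  gcongr
  exact mul_le_of_le_one_left (sqrt_nonneg _) hτ

lemma exists_gaussianQ_le_binomialTail (hp0 : 0 < p) (hp1 : p < 1) (z : ℝ) :
    ∃ B : ℕ, ∀ᶠ n : ℕ in atTop, gaussianQ z ≤ binomialTail p n (normalQuantile p n z - B) := by
  obtain ⟨C, hC⟩ := exists_abs_binomialTail_sub_gaussianQ_le hp0 hp1 z
  obtain ⟨B, hB⟩ := exists_binomialTail_add_le hp0 hp1 (|z| + 1) C
  refine ⟨B, ?_⟩
  filter_upwards [hC, hB, eventually_le_sqrt_natCast B] with n hC hB hn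
  have hnear : |normalQuantile p n z - B - n * p| ≤ (|z| + 1) * √n := by
    have hx := abs_le.mp (abs_normalQuantile_sub_le hp0 hp1 n z)
    have : (0 : ℝ) ≤ B := B.cast_nonneg
    exact abs_le.mpr ⟨by linarith, by linarith⟩
  have hshift := hB _ hnear
  rw [sub_add_cancel] at hshift
  linarith [(abs_le.mp hC).1]

lemma exists_binomialTail_add_le_gaussianQ (hp0 : 0 < p) (hp1 : p < 1) (z D : ℝ) :
    ∃ B : ℕ, ∀ᶠ n : ℕ in atTop,
      binomialTail p n (normalQuantile p n z + B) + D / √n ≤ gaussianQ z := by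
  obtain ⟨C, hC⟩ := exists_abs_binomialTail_sub_gaussianQ_le hp0 hp1 z
  obtain ⟨B, hB⟩ := exists_binomialTail_add_le hp0 hp1 |z| (C + D)
  refine ⟨B, ?_⟩
  filter_upwards [hC, hB] with n hC hB
  have hshift := hB _ (abs_normalQuantile_sub_le hp0 hp1 n z)
  rw [add_div] at hshift
  linarith [(abs_le.mp hC).2]

end TailShift

section HammingBall

/-- The proportion of words of `{±1}ⁿ` within Hamming distance `k` of a fixed word. -/
noncomputable def ballFraction (n k : ℕ) : ℝ :=
  (∑ j ∈ range (k + 1), (n.choose j : ℝ)) / 2 ^ n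

lemma sum_hammingDist {ι M : Type*} [Fintype ι] [DecidableEq ι] [AddCommMonoid M]
    (x : ι → ℤˣ) (F : ℕ → M) :
    ∑ y : ι → ℤˣ, F (hammingDist y x) =
      ∑ k ∈ range (Fintype.card ι + 1), (Fintype.card ι).choose k • F k := by
  rw [← card_univ, ← sum_powerset_apply_card F]
  refine sum_bij' (fun y _ => ({i | y i ≠ x i} : Finset ι))
    (fun s _ i => if i ∈ s then -x i else x i) ?_ ?_ ?_ ?_ ?_
  · intro y _
    simp
  · intro s _
    simp
  · intro y _
    funext i
    by_cases hi : y i = x i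
    · simp [hi]
    · simp [Int.units_ne_iff_eq_neg.mp hi]
  · intro s _
    ext i
    by_cases hi : i ∈ s <;> simp [hi]
  · intro y _
    rfl

lemma card_hammingDist_le_div (n : ℕ) (x : Fin n → ℤˣ) (k : ℕ) :
    (#{z : Fin n → ℤˣ | hammingDist x z ≤ k} : ℝ) / Fintype.card (Fin n → ℤˣ) =
      ballFraction n k := by
  have hball := sum_hammingDist x fun d => if d ≤ k then (1 : ℝ) else 0
  simp only [hammingDist_comm _ x] at hball
  rw [sum_boole, Fintype.card_fin] at hball
  rw [hball, ballFraction]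
  congr 1
  · simp only [nsmul_eq_mul, mul_ite, mul_one, mul_zero]
    rw [← sum_filter]
    refine sum_subset_zero_on_sdiff (fun j hj => ?_) (fun j hj => ?_) fun _ _ => rfl
    · exact mem_range.mpr (Nat.lt_succ_of_le (mem_filter.mp hj).2)
    · rw [Finset.mem_sdiff, mem_filter, mem_range, mem_range] at hj
      rw [Nat.choose_eq_zero_of_lt (by omega), Nat.cast_zero]
  · simp

lemma ballFraction_pos (n k : ℕ) : 0 < ballFraction n k :=
  div_pos (sum_pos' (fun _ _ => by positivity) ⟨0, by simp, by simp⟩) (by positivity)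

lemma ballFraction_mono (n : ℕ) : Monotone (ballFraction n) := by
  intro j k h
  unfold ballFraction
  gcongr

lemma ballFraction_succ (n k : ℕ) :
    ballFraction n (k + 1) = ballFraction n k + n.choose (k + 1) / 2 ^ n := by
  rw [ballFraction, sum_range_succ, add_div, ← ballFraction]

lemma choose_div_le_ballFraction (n k : ℕ) : (n.choose k : ℝ) / 2 ^ n ≤ ballFraction n k := by
  unfold ballFraction
  gcongr
  exact single_le_sum (f := fun j => (n.choose j : ℝ)) (fun _ _ => by positivity)
    (self_mem_range_succ k)

variable {n K : ℕ} {r : ℝ}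

lemma choose_le_mul_choose_succ (hr : 0 ≤ r) {j : ℕ}
    (hj : ((j + 1 : ℕ) : ℝ) ≤ r * (n - (j + 1 : ℕ))) :
    (n.choose j : ℝ) ≤ r * n.choose (j + 1) := by
  have hjn : j < n := by
    by_contra! hnj
    have hnj' : (n : ℝ) - (j + 1 : ℕ) ≤ 0 := by
      rw [sub_nonpos]
      exact_mod_cast hnj.trans j.le_succ
    have hsucc : (0 : ℝ) < (j + 1 : ℕ) := by positivity
    exact (hj.trans (mul_nonpos_of_nonneg_of_nonpos hr hnj')).not_gt hsucc
  have hpos : (0 : ℝ) < (n - j : ℕ) := by exact_mod_cast Nat.sub_pos_of_lt hjn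
  refine le_of_mul_le_mul_right ?_ hpos
  calc (n.choose j : ℝ) * (n - j : ℕ) = n.choose (j + 1) * (j + 1 : ℕ) := by
        exact_mod_cast (Nat.choose_succ_right_eq n j).symm
    _ ≤ n.choose (j + 1) * (r * (n - j : ℕ)) := by
        gcongr
        refine hj.trans (mul_le_mul_of_nonneg_left ?_ hr)
        rw [Nat.cast_sub hjn.le, Nat.cast_succ]
        linarith
    _ = r * n.choose (j + 1) * (n - j : ℕ) := by ring

lemma ballFraction_le_mul_succ (hr : 0 ≤ r) (hK : ((K + 1 : ℕ) : ℝ) ≤ r * (n - (K + 1 : ℕ))) :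
    ballFraction n K ≤ r * ballFraction n (K + 1) := by
  unfold ballFraction
  rw [← mul_div_assoc, mul_sum, sum_range_succ' _ (K + 1)]
  gcongr
  refine le_add_of_le_of_nonneg (sum_le_sum fun j hj => choose_le_mul_choose_succ hr ?_)
    (by positivity)
  have hjK : ((j + 1 : ℕ) : ℝ) ≤ (K + 1 : ℕ) := by exact_mod_cast mem_range.mp hj
  exact hjK.trans (hK.trans (by gcongr))

lemma ballFraction_le_pow_mul (hr : 0 ≤ r) (hK : (K : ℝ) ≤ r * (n - K)) {k : ℕ} (hk : k ≤ K) :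
    ballFraction n k ≤ r ^ (K - k) * ballFraction n K := by
  induction K, hk using Nat.le_induction with
  | base => simp
  | succ K hk ih =>
    have hK' : (K : ℝ) ≤ r * (n - K) := by
      push_cast at hK
      linarith
    rw [Nat.succ_sub hk, pow_succ, mul_assoc]
    exact (ih hK').trans (by gcongr; exact ballFraction_le_mul_succ hr hK)

lemma one_sub_mul_ballFraction_le (hr : 0 ≤ r) (hK : (K : ℝ) ≤ r * (n - K)) :
    (1 - r) * ballFraction n K ≤ n.choose K / 2 ^ n := by
  cases K with
  | zero =>
    have hzero : ballFraction n 0 = n.choose 0 / 2 ^ n := by simp [ballFraction]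
    linarith [mul_nonneg hr (ballFraction_pos n 0).le]
  | succ K => linarith [ballFraction_le_mul_succ hr hK, ballFraction_succ n K]

end HammingBall

section RandomCodingUnion

variable {p : ℝ} {n : ℕ}

lemma logLikelihood_bsc_le_iff (hp0 : 0 < p) (hp1 : p < 1 / 2) (hn : 1 ≤ n)
    (x z y : Fin n → ℤˣ) :
    logLikelihood n (bscTransition p n) (bscOutput n) x y ≤
      logLikelihood n (bscTransition p n) (bscOutput n) z y ↔
    hammingDist y z ≤ hammingDist y x := by
  have hq : 0 < 1 - p := by linarith
  have hr0 : 0 < p / (1 - p) := by positivity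
  have hr1 : p / (1 - p) < 1 := by rw [div_lt_one hq]; linarith
  have hpos : ∀ a, 0 < bscTransition p n a y / bscOutput n y := fun a => by
    unfold bscTransition bscOutput; positivity
  unfold logLikelihood
  rw [mul_le_mul_iff_right₀ (by positivity), log_le_log_iff (hpos x) (hpos z)]
  unfold bscTransition bscOutput
  rw [div_le_div_iff_of_pos_right (by positivity), mul_le_mul_iff_right₀ (by positivity),
    pow_le_pow_iff_right_of_lt_one₀ hr0 hr1]

lemma pairwiseError_bsc (hp0 : 0 < p) (hp1 : p < 1 / 2) (hn : 1 ≤ n) (x y : Fin n → ℤˣ) :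
    pairwiseError n (bscTransition p n) (bscOutput n) x y = ballFraction n (hammingDist y x) := by
  simp only [pairwiseError, logLikelihood_bsc_le_iff hp0 hp1 hn]
  rw [← card_hammingDist_le_div n y]

lemma bscRCU_eq (hp0 : 0 < p) (hp1 : p < 1 / 2) (hn : 1 ≤ n) (R : ℝ) :
    bscRCU p n R = ∑ k ∈ range (n + 1),
      binomialMass p n k * min 1 ((2 : ℝ) ^ (n * R) * ballFraction n k) := by
  have hq : 0 < 1 - p := by linarith
  have hmass : ∀ k ∈ range (n + 1),
      n.choose k * ((1 - p) ^ n * (p / (1 - p)) ^ k) = binomialMass p n k := fun k hk => by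
    rw [← pow_sub_mul_pow (1 - p) (Nat.lt_succ_iff.mp (mem_range.mp hk)), binomialMass, div_pow]
    field_simp
  unfold bscRCU rcuBound
  simp only [pairwiseError_bsc hp0 hp1 hn, bscTransition]
  simp only [fun x : Fin n → ℤˣ => sum_hammingDist x fun d => (1 - p) ^ n * (p / (1 - p)) ^ d *
    min 1 ((2 : ℝ) ^ (n * R) * ballFraction n d)]
  rw [sum_const, card_univ, nsmul_eq_mul, ← mul_assoc, mul_one_div_cancel
    (by exact_mod_cast Fintype.card_ne_zero), one_mul, Fintype.card_fin]
  refine sum_congr rfl fun k hk => ?_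
  rw [nsmul_eq_mul, ← mul_assoc, hmass k hk]

lemma bscRCU_continuous (hp0 : 0 < p) (hp1 : p < 1 / 2) (hn : 1 ≤ n) :
    Continuous (bscRCU p n) := by
  rw [funext (bscRCU_eq hp0 hp1 hn)]
  refine continuous_finsetSum _ fun k _ => continuous_const.mul (continuous_const.min ?_)
  exact (continuous_const.rpow (by fun_prop) fun _ => Or.inl two_ne_zero).mul continuous_const

lemma bscRCU_monotone (hp0 : 0 < p) (hp1 : p < 1 / 2) (hn : 1 ≤ n) :
    Monotone (bscRCU p n) := by
  intro R S h
  rw [bscRCU_eq hp0 hp1 hn, bscRCU_eq hp0 hp1 hn]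
  refine sum_le_sum fun k _ => ?_
  have hball := (ballFraction_pos n k).le
  have hmass := binomialMass_nonneg hp0.le (by linarith) n k
  gcongr
  exact one_le_two

lemma bscRCU_lt_of_lt (hp0 : 0 < p) (hp1 : p < 1 / 2) (hn : 1 ≤ n) {R S : ℝ}
    (h : R < S) (hR : bscRCU p n R < 1) : bscRCU p n R < bscRCU p n S := by
  have hp1' : p < 1 := by linarith
  have hexp : (2 : ℝ) ^ (n * R) < (2 : ℝ) ^ (n * S) :=
    rpow_lt_rpow_of_exponent_lt one_lt_two (mul_lt_mul_of_pos_left h (by positivity))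
  refine (bscRCU_monotone hp0 hp1 hn h.le).lt_of_ne fun heq => hR.not_ge ?_
  rw [bscRCU_eq hp0 hp1 hn, bscRCU_eq hp0 hp1 hn] at heq
  have hterm := (sum_eq_sum_iff_of_le fun k _ => mul_le_mul_of_nonneg_left
    (min_le_min_left 1 (mul_le_mul_of_nonneg_right hexp.le (ballFraction_pos n k).le))
    (binomialMass_nonneg hp0.le hp1'.le n k)).mp heq
  rw [bscRCU_eq hp0 hp1 hn]
  refine (sum_binomialMass p n).ge.trans (sum_le_sum fun k hk => ?_)
  have hmin := mul_left_cancel₀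
    (binomialMass_pos hp0 hp1' (Nat.lt_succ_iff.mp (mem_range.mp hk))).ne' (hterm k hk)
  have hball := mul_lt_mul_of_pos_right hexp (ballFraction_pos n k)
  rw [min_eq_left, mul_one]
  by_contra! hlt
  rw [min_eq_right hlt.le] at hmin
  exact (lt_min hlt hball).ne hmin

lemma exists_bscRCU_le (hp0 : 0 < p) (hp1 : p < 1 / 2) (hn : 1 ≤ n) {e : ℝ} (he0 : 0 < e) :
    ∃ R, bscRCU p n R ≤ e := by
  refine ⟨logb 2 (e / ballFraction n n) / n, ?_⟩
  have hn' : (n : ℝ) ≠ 0 := by positivity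
  have hball := ballFraction_pos n n
  rw [bscRCU_eq hp0 hp1 hn, mul_div_cancel₀ _ hn',
    rpow_logb two_pos (by norm_num) (by positivity)]
  calc ∑ k ∈ range (n + 1), binomialMass p n k * min 1 (e / ballFraction n n * ballFraction n k)
      ≤ ∑ k ∈ range (n + 1), binomialMass p n k * e := by
        refine sum_le_sum fun k hk => mul_le_mul_of_nonneg_left ((min_le_right _ _).trans ?_)
          (binomialMass_nonneg hp0.le (by linarith) n k)
        calc e / ballFraction n n * ballFraction n k ≤ e / ballFraction n n * ballFraction n n := by
              gcongr
              exact ballFraction_mono n (Nat.lt_succ_iff.mp (mem_range.mp hk))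
          _ = e := div_mul_cancel₀ _ hball.ne'
    _ = e := by rw [← sum_mul, sum_binomialMass, one_mul]

lemma one_le_bscRCU_one (hp0 : 0 < p) (hp1 : p < 1 / 2) (hn : 1 ≤ n) : 1 ≤ bscRCU p n 1 := by
  rw [bscRCU_eq hp0 hp1 hn]
  refine (sum_binomialMass p n).ge.trans (sum_le_sum fun k _ => ?_)
  have hball : 1 ≤ (2 : ℝ) ^ (n * (1 : ℝ)) * ballFraction n k :=
    calc (1 : ℝ) = 2 ^ n * (n.choose 0 / 2 ^ n) := by
          rw [Nat.choose_zero_right, Nat.cast_one, mul_one_div_cancel (by positivity)]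
      _ ≤ 2 ^ n * ballFraction n k := by
          gcongr
          exact (choose_div_le_ballFraction n 0).trans (ballFraction_mono n k.zero_le)
      _ = (2 : ℝ) ^ (n * (1 : ℝ)) * ballFraction n k := by rw [mul_one, rpow_natCast]
  rw [min_eq_left hball, mul_one]

lemma exists_bscRCU_eq (hp0 : 0 < p) (hp1 : p < 1 / 2) (hn : 1 ≤ n) {e : ℝ} (he0 : 0 < e)
    (he1 : e ≤ 1) : ∃ R, bscRCU p n R = e :=
  mem_range_of_exists_le_of_exists_ge (bscRCU_continuous hp0 hp1 hn)
    (exists_bscRCU_le hp0 hp1 hn he0) ⟨1, he1.trans (one_le_bscRCU_one hp0 hp1 hn)⟩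

lemma isGreatest_bscRCURate (hp0 : 0 < p) (hp1 : p < 1 / 2) (hn : 1 ≤ n) {e : ℝ}
    (he0 : 0 < e) (he1 : e < 1) : IsGreatest {R : ℝ | bscRCU p n R ≤ e} (bscRCURate p n e) := by
  obtain ⟨r, hr⟩ := exists_bscRCU_eq hp0 hp1 hn he0 he1.le
  have hgreatest : IsGreatest {R : ℝ | bscRCU p n R ≤ e} r := by
    refine ⟨hr.le, fun S hS => le_of_not_gt fun hrS => ?_⟩
    exact (bscRCU_lt_of_lt hp0 hp1 hn hrS (hr.trans_lt he1)).not_ge (hS.out.trans hr.ge)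
  rwa [bscRCURate, hgreatest.csSup_eq]

lemma bscRCU_eq_iff (hp0 : 0 < p) (hp1 : p < 1 / 2) (hn : 1 ≤ n) {e : ℝ} (he0 : 0 < e)
    (he1 : e < 1) (R : ℝ) : bscRCU p n R = e ↔ R = bscRCURate p n e := by
  have hgreatest := isGreatest_bscRCURate hp0 hp1 hn he0 he1
  have hunique : ∀ R, bscRCU p n R = e → R = bscRCURate p n e := fun R hR => by
    refine (hgreatest.2 hR.le).antisymm (le_of_not_gt fun hlt => ?_)
    exact (bscRCU_lt_of_lt hp0 hp1 hn hlt (hR.trans_lt he1)).not_ge (hgreatest.1.out.trans hR.ge)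
  refine ⟨hunique R, fun hR => ?_⟩
  obtain ⟨r, hr⟩ := exists_bscRCU_eq hp0 hp1 hn he0 he1.le
  rw [hR, ← hunique r hr, hr]

lemma abs_bscRCURate_sub_le (hp0 : 0 < p) (hp1 : p < 1 / 2) (hn : 1 ≤ n) {e : ℝ}
    (he0 : 0 < e) (he1 : e < 1) {N d : ℝ} (hlo : bscRCU p n (N - d) ≤ e)
    (hhi : e ≤ bscRCU p n (N + d)) : |bscRCURate p n e - N| ≤ d := by
  have hgreatest := isGreatest_bscRCURate hp0 hp1 hn he0 he1
  have hlower : N - d ≤ bscRCURate p n e := hgreatest.2 hlo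
  have hupper : bscRCURate p n e ≤ N + d := le_of_not_gt fun h =>
    h.ne ((bscRCU_eq_iff hp0 hp1 hn he0 he1 _).mp
      (((bscRCU_monotone hp0 hp1 hn h.le).trans hgreatest.1).antisymm hhi))
  exact abs_le.mpr ⟨by linarith, by linarith⟩

lemma binomialTail_le_bscRCU (hp0 : 0 < p) (hp1 : p < 1 / 2) (hn : 1 ≤ n) {y R : ℝ}
    (h : 1 ≤ (2 : ℝ) ^ (n * R) * ballFraction n ⌊y⌋₊) : binomialTail p n y ≤ bscRCU p n R := by
  have hmass := binomialMass_nonneg hp0.le (by linarith) n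
  rw [bscRCU_eq hp0 hp1 hn, binomialTail, sum_filter]
  refine sum_le_sum fun k _ => ?_
  split_ifs with hk
  · have hball : ballFraction n ⌊y⌋₊ ≤ ballFraction n k :=
      ballFraction_mono n (Nat.floor_le_of_le hk.le)
    rw [min_eq_left (h.trans (by gcongr)), mul_one]
  · exact mul_nonneg (hmass k) (le_min zero_le_one
      (mul_nonneg (by positivity) (ballFraction_pos n k).le))

lemma sum_range_pow_sub_le {r : ℝ} (hr0 : 0 ≤ r) (hr1 : r < 1) (K : ℕ) :
    ∑ k ∈ range (K + 1), r ^ (K - k) ≤ (1 - r)⁻¹ := by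
  have hreflect := sum_range_reflect (fun k => r ^ k) (K + 1)
  rw [Nat.add_sub_cancel] at hreflect
  rw [hreflect, ← tsum_geometric_of_lt_one hr0 hr1]
  exact (summable_geometric_of_lt_one hr0 hr1).sum_le_tsum _ fun _ _ => by positivity

lemma bscRCU_le_add_binomialTail (hp0 : 0 < p) (hp1 : p < 1 / 2) (hn : 1 ≤ n) {r β R : ℝ} {K : ℕ}
    (hr0 : 0 ≤ r) (hr1 : r < 1) (hK : (K : ℝ) ≤ r * (n - K)) (hβ : ∀ k, binomialMass p n k ≤ β)
    (h : (2 : ℝ) ^ (n * R) * ballFraction n K ≤ 1) :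
    bscRCU p n R ≤ β / (1 - r) + binomialTail p n K := by
  have hmass := binomialMass_nonneg hp0.le (by linarith) n
  have hβ0 : 0 ≤ β := (hmass 0).trans (hβ 0)
  have hKn : K ≤ n := by
    by_contra! hnK
    have hnK' : (n : ℝ) < K := by exact_mod_cast hnK
    have : (0 : ℝ) ≤ n := n.cast_nonneg
    linarith [mul_nonpos_of_nonneg_of_nonpos hr0 (sub_nonpos.mpr hnK'.le)]
  have hgeom : ∀ k ≤ K, (2 : ℝ) ^ (n * R) * ballFraction n k ≤ r ^ (K - k) := fun k hk =>
    calc (2 : ℝ) ^ (n * R) * ballFraction n k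
        ≤ (2 : ℝ) ^ (n * R) * (r ^ (K - k) * ballFraction n K) := by
          gcongr
          exact ballFraction_le_pow_mul hr0 hK hk
      _ = r ^ (K - k) * ((2 : ℝ) ^ (n * R) * ballFraction n K) := by ring
      _ ≤ r ^ (K - k) := mul_le_of_le_one_right (by positivity) h
  have hbelow : {k ∈ range (n + 1) | ¬ (K : ℝ) < (k : ℕ)} = range (K + 1) := by
    ext k
    simp only [mem_filter, mem_range, Nat.cast_lt]
    omega
  rw [bscRCU_eq hp0 hp1 hn, ← sum_filter_not_add_sum_filter _ fun k : ℕ => (K : ℝ) < k, hbelow]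
  refine add_le_add ?_ (sum_le_sum fun k _ => mul_le_of_le_one_right (hmass k) (min_le_left _ _))
  calc ∑ k ∈ range (K + 1), binomialMass p n k * min 1 ((2 : ℝ) ^ (n * R) * ballFraction n k)
      ≤ ∑ k ∈ range (K + 1), β * r ^ (K - k) := by
        refine sum_le_sum fun k hk => mul_le_mul (hβ k) ((min_le_right _ _).trans
          (hgeom k (Nat.lt_succ_iff.mp (mem_range.mp hk)))) ?_ hβ0
        exact le_min zero_le_one (mul_nonneg (by positivity) (ballFraction_pos n k).le)
    _ ≤ β / (1 - r) := by
        rw [← mul_sum, div_eq_mul_inv]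
        exact mul_le_mul_of_nonneg_left (sum_range_pow_sub_le hr0 hr1 K) hβ0

end RandomCodingUnion

section NormalApproximation

variable {p : ℝ} {n : ℕ}

lemma log_one_sub_div_nonneg (hp0 : 0 < p) (hp1 : p ≤ 1 / 2) : 0 ≤ log ((1 - p) / p) :=
  log_nonneg ((one_le_div hp0).mpr (by linarith))

lemma sqrt_bscDispersion_div (hp0 : 0 < p) (hp1 : p ≤ 1 / 2) (n : ℕ) :
    √(bscDispersion p / n) = √(p * (1 - p)) * log ((1 - p) / p) / √n := by
  have hq : 0 ≤ 1 - p := by linarith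
  rw [bscDispersion, sqrt_div' _ n.cast_nonneg, sqrt_mul (by positivity),
    sqrt_sq (log_one_sub_div_nonneg hp0 hp1)]

lemma two_rpow_mul_normalApprox (hp0 : 0 < p) (hp1 : p ≤ 1 / 2) (hn : 1 ≤ n) (e : ℝ) :
    (2 : ℝ) ^ (n * normalApprox (bscCapacity p) (bscDispersion p) n e) = 2 ^ n * √n *
      exp (-(n * binEntropy p + binomialStdDev p n * gaussianQInv e * log ((1 - p) / p))) := by
  have hn0 : (0 : ℝ) < n := by positivity
  have hs0 : 0 < √(n : ℝ) := sqrt_pos.mpr hn0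
  have : 0 < log 2 := log_pos one_lt_two
  have hexponent : log 2 * (n * normalApprox (bscCapacity p) (bscDispersion p) n e) =
      n * log 2 + log n / 2 -
        (n * binEntropy p + binomialStdDev p n * gaussianQInv e * log ((1 - p) / p)) := by
    rw [normalApprox, bscCapacity, logb, logb, sqrt_bscDispersion_div hp0 hp1, log_exp,
      binomialStdDev_eq_mul_sqrt]
    field_simp
    linear_combination
      2 * √(p * (1 - p)) * log ((1 - p) / p) * gaussianQInv e * sq_sqrt hn0.le
  have hsqrt : exp (log n / 2) = √n := by rw [← log_sqrt hn0.le, exp_log hs0]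
  rw [rpow_def_of_pos two_pos, hexponent, sub_eq_add_neg, exp_add, exp_add, hsqrt, exp_nat_mul,
    exp_log two_pos]

lemma binomialMass_eq_choose_mul_exp (hp0 : 0 < p) (hp1 : p < 1) {k : ℕ} (hk : k ≤ n) :
    binomialMass p n k =
      n.choose k * exp (-(n * binEntropy p + (k - n * p) * log ((1 - p) / p))) := by
  have hq : 0 < 1 - p := by linarith
  have hexponent : -(n * binEntropy p + (k - n * p) * log ((1 - p) / p)) =
      k * log p + (n - k : ℕ) * log (1 - p) := by
    rw [binEntropy, log_inv, log_inv, log_div hq.ne' hp0.ne', Nat.cast_sub hk]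
    ring
  rw [hexponent, exp_add, exp_nat_mul, exp_nat_mul, exp_log hp0, exp_log hq, ← mul_assoc,
    binomialMass]

lemma two_rpow_normalApprox_mul_choose (hp0 : 0 < p) (hp1 : p ≤ 1 / 2) (e : ℝ) {k : ℕ}
    (hn : 1 ≤ n) (hk : k ≤ n) :
    (2 : ℝ) ^ (n * normalApprox (bscCapacity p) (bscDispersion p) n e) * (n.choose k / 2 ^ n) =
      √n * binomialMass p n k *
        exp ((k - normalQuantile p n (gaussianQInv e)) * log ((1 - p) / p)) := by
  have hexponent :
      -(n * binEntropy p + binomialStdDev p n * gaussianQInv e * log ((1 - p) / p)) =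
        -(n * binEntropy p + (k - n * p) * log ((1 - p) / p)) +
          (k - normalQuantile p n (gaussianQInv e)) * log ((1 - p) / p) := by
    rw [normalQuantile]
    ring
  rw [two_rpow_mul_normalApprox hp0 hp1 hn, binomialMass_eq_choose_mul_exp hp0 (by linarith) hk,
    hexponent, exp_add]
  field_simp

lemma two_rpow_mul_add_logb_div (hn : 1 ≤ n) (N : ℝ) {X : ℝ} (hX : 0 < X) :
    (2 : ℝ) ^ (n * (N + logb 2 X / n)) = (2 : ℝ) ^ (n * N) * X := by
  have hn0 : (n : ℝ) ≠ 0 := by positivity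
  rw [mul_add, mul_div_cancel₀ _ hn0, rpow_add two_pos, rpow_logb two_pos (by norm_num) hX]

lemma one_le_two_rpow_mul_ballFraction (hp0 : 0 < p) (hp1 : p ≤ 1 / 2) (hn : 1 ≤ n) (e : ℝ)
    {c B : ℝ} (hc : 0 < c) {k : ℕ} (hk : k ≤ n) (hmass : c / √n ≤ binomialMass p n k)
    (hkB : normalQuantile p n (gaussianQInv e) ≤ k + B) :
    1 ≤ (2 : ℝ) ^ (n * (normalApprox (bscCapacity p) (bscDispersion p) n e +
      logb 2 (exp (B * log ((1 - p) / p)) / c) / n)) * ballFraction n k := by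
  have hθ := log_one_sub_div_nonneg hp0 hp1
  set θ := log ((1 - p) / p)
  set x := normalQuantile p n (gaussianQInv e)
  have : 0 < √(n : ℝ) := by positivity
  have hmass0 : 0 ≤ binomialMass p n k := (by positivity : 0 ≤ c / √n).trans hmass
  rw [two_rpow_mul_add_logb_div hn _ (by positivity)]
  set M := (2 : ℝ) ^ (n * normalApprox (bscCapacity p) (bscDispersion p) n e)
  calc (1 : ℝ) = √n * (c / √n) * exp (-(B * θ)) * (exp (B * θ) / c) := by
        rw [exp_neg]
        field_simp
    _ ≤ √n * binomialMass p n k * exp ((k - x) * θ) * (exp (B * θ) / c) := by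
        gcongr
        rw [← neg_mul]
        gcongr
        linarith
    _ = M * (exp (B * θ) / c) * (n.choose k / 2 ^ n) := by
        rw [← two_rpow_normalApprox_mul_choose hp0 hp1 e hn hk]
        ring
    _ ≤ M * (exp (B * θ) / c) * ballFraction n k := by
        gcongr
        exact choose_div_le_ballFraction n k

lemma two_rpow_mul_ballFraction_le_one (hp0 : 0 < p) (hp1 : p ≤ 1 / 2) (hn : 1 ≤ n) (e : ℝ)
    {C B r : ℝ} (hC : 0 < C) (hr0 : 0 ≤ r) (hr1 : r < 1) {k : ℕ} (hk : k ≤ n)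
    (hkr : (k : ℝ) ≤ r * (n - k)) (hmass : binomialMass p n k ≤ C / √n)
    (hkB : k ≤ normalQuantile p n (gaussianQInv e) + B) :
    (2 : ℝ) ^ (n * (normalApprox (bscCapacity p) (bscDispersion p) n e -
      logb 2 (C * exp (B * log ((1 - p) / p)) / (1 - r)) / n)) * ballFraction n k ≤ 1 := by
  have hθ := log_one_sub_div_nonneg hp0 hp1
  set θ := log ((1 - p) / p)
  set x := normalQuantile p n (gaussianQInv e)
  have hr : 0 < 1 - r := sub_pos.mpr hr1
  have : 0 < √(n : ℝ) := by positivity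
  rw [sub_eq_add_neg, ← neg_div, ← logb_inv, two_rpow_mul_add_logb_div hn _ (by positivity)]
  set M := (2 : ℝ) ^ (n * normalApprox (bscCapacity p) (bscDispersion p) n e)
  set X := C * exp (B * θ) / (1 - r) with hX
  refine le_of_mul_le_mul_left ?_ hr
  calc (1 - r) * (M * X⁻¹ * ballFraction n k) = M * X⁻¹ * ((1 - r) * ballFraction n k) := by ring
    _ ≤ M * X⁻¹ * (n.choose k / 2 ^ n) := by
        gcongr
        exact one_sub_mul_ballFraction_le hr0 hkr
    _ = X⁻¹ * (√n * binomialMass p n k * exp ((k - x) * θ)) := by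
        rw [← two_rpow_normalApprox_mul_choose hp0 hp1 e hn hk]
        ring
    _ ≤ X⁻¹ * (√n * (C / √n) * exp (B * θ)) := by
        gcongr
        linarith
    _ = (1 - r) * 1 := by
        rw [hX]
        field_simp

lemma exists_le_bscRCU_normalApprox (hp0 : 0 < p) (hp1 : p < 1 / 2) {e : ℝ} (he0 : 0 < e)
    (he1 : e < 1) : ∃ D : ℝ, ∀ᶠ n : ℕ in atTop,
      e ≤ bscRCU p n (normalApprox (bscCapacity p) (bscDispersion p) n e + D / n) := by
  have hp1' : p < 1 := by linarith
  set z := gaussianQInv e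
  obtain ⟨B, hB⟩ := exists_gaussianQ_le_binomialTail hp0 hp1' z
  obtain ⟨c, hc, hmass⟩ := exists_le_binomialMass_of_abs_sub_le hp0 hp1' (|z| + 1)
  refine ⟨logb 2 (exp ((B + 1) * log ((1 - p) / p)) / c), ?_⟩
  filter_upwards [hB, hmass, eventually_nonneg_of_abs_sub_le hp0 (|z| + 1),
    eventually_le_sqrt_natCast (B + 1), eventually_ge_atTop 1] with n hB hmass hnonneg hs hn
  obtain ⟨hx_ge, hx_le⟩ := abs_le.mp (abs_normalQuantile_sub_le hp0 hp1' n z)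
  have : (0 : ℝ) ≤ B := B.cast_nonneg
  set y := normalQuantile p n z - B
  have hy0 : 0 ≤ y := hnonneg y (abs_le.mpr ⟨by linarith, by linarith⟩)
  have hfloor_le : (⌊y⌋₊ : ℝ) ≤ y := Nat.floor_le hy0
  have hlt_floor : y < ⌊y⌋₊ + 1 := Nat.lt_floor_add_one y
  obtain ⟨hkn, hmass⟩ := hmass ⌊y⌋₊ (abs_le.mpr ⟨by linarith, by linarith⟩)
  calc e = gaussianQ z := (gaussianQ_gaussianQInv he0 he1).symm
    _ ≤ binomialTail p n y := hB
    _ ≤ _ := binomialTail_le_bscRCU hp0 hp1 hn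
        (one_le_two_rpow_mul_ballFraction hp0 hp1.le hn e hc hkn hmass (by linarith))

lemma exists_bscRCU_normalApprox_le (hp0 : 0 < p) (hp1 : p < 1 / 2) {e : ℝ} (he0 : 0 < e)
    (he1 : e < 1) : ∃ D : ℝ, ∀ᶠ n : ℕ in atTop,
      bscRCU p n (normalApprox (bscCapacity p) (bscDispersion p) n e - D / n) ≤ e := by
  have hp1' : p < 1 := by linarith
  have hq : 0 < 1 - p := by linarith
  set z := gaussianQInv e
  obtain ⟨r, hpr, hr1⟩ := exists_between (show p / (1 - p) < 1 by rw [div_lt_one hq]; linarith)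
  have hr0 : 0 ≤ r := (div_pos hp0 hq).le.trans hpr.le
  obtain ⟨C, hC, hmass⟩ := exists_binomialMass_le hp0 hp1'
  obtain ⟨B, hB⟩ := exists_binomialTail_add_le_gaussianQ hp0 hp1' z (C / (1 - r))
  refine ⟨logb 2 (C * exp (B * log ((1 - p) / p)) / (1 - r)), ?_⟩
  filter_upwards [hB, hmass, eventually_nonneg_of_abs_sub_le hp0 (|z| + 1),
    eventually_le_mul_sub_of_abs_sub_le hr0 ((div_lt_iff₀ hq).mp hpr) (|z| + 1),
    eventually_le_sqrt_natCast (B + 1), eventually_pos_and_lt_of_abs_sub_le hp0 hp1' (|z| + 1)]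
    with n hB hmass hnonneg hratio hs hrange
  obtain ⟨hx_ge, hx_le⟩ := abs_le.mp (abs_normalQuantile_sub_le hp0 hp1' n z)
  have : (0 : ℝ) ≤ B := B.cast_nonneg
  set y := normalQuantile p n z + B
  have hy0 : 0 ≤ y := hnonneg y (abs_le.mpr ⟨by linarith, by linarith⟩)
  have hfloor_le : (⌊y⌋₊ : ℝ) ≤ y := Nat.floor_le hy0
  have hlt_floor : y < ⌊y⌋₊ + 1 := Nat.lt_floor_add_one y
  have hnear : |⌊y⌋₊ - n * p| ≤ (|z| + 1) * √n := abs_le.mpr ⟨by linarith, by linarith⟩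
  obtain ⟨-, hkn⟩ := hrange _ hnear
  have hn : 1 ≤ n := Nat.one_le_of_lt hkn
  have hkr := hratio _ hnear
  calc bscRCU p n _ ≤ C / √n / (1 - r) + binomialTail p n ⌊y⌋₊ :=
        bscRCU_le_add_binomialTail hp0 hp1 hn hr0 hr1 hkr hmass
          (two_rpow_mul_ballFraction_le_one hp0 hp1.le hn e hC hr0 hr1 hkn.le hkr (hmass _)
            hfloor_le)
    _ = binomialTail p n y + C / (1 - r) / √n := by
        rw [binomialTail_natFloor hy0, div_right_comm, add_comm]
    _ ≤ gaussianQ z := hB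
    _ = e := gaussianQ_gaussianQInv he0 he1

end NormalApproximation

theorem mainTheorem5 (p : ℝ) (hp0 : 0 < p) (hp1 : p < 1 / 2)
    (Pe : ℝ) (hPe0 : 0 < Pe) (hPe1 : Pe < 1) :
    (∀ n : ℕ, 1 ≤ n →
      IsGreatest {R : ℝ | bscRCU p n R ≤ Pe} (bscRCURate p n Pe) ∧
      ∀ R : ℝ, bscRCU p n R = Pe ↔ R = bscRCURate p n Pe) ∧
    (fun n : ℕ => bscRCURate p n Pe
        - normalApprox (bscCapacity p) (bscDispersion p) n Pe)
      =O[atTop] (fun n : ℕ => 1 / (n : ℝ)) := by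
  refine ⟨fun n hn => ⟨isGreatest_bscRCURate hp0 hp1 hn hPe0 hPe1,
    bscRCU_eq_iff hp0 hp1 hn hPe0 hPe1⟩, ?_⟩
  obtain ⟨D₁, h₁⟩ := exists_le_bscRCU_normalApprox hp0 hp1 hPe0 hPe1
  obtain ⟨D₂, h₂⟩ := exists_bscRCU_normalApprox_le hp0 hp1 hPe0 hPe1
  refine IsBigO.of_bound (max D₁ D₂) ?_
  filter_upwards [h₁, h₂, eventually_ge_atTop 1] with n h₁ h₂ hn
  rw [norm_eq_abs, norm_of_nonneg (by positivity), mul_one_div]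
  refine abs_bscRCURate_sub_le hp0 hp1 hn hPe0 hPe1 ?_ ?_
  · refine (bscRCU_monotone hp0 hp1 hn ?_).trans h₂
    gcongr
    exact le_max_right _ _
  · refine h₁.trans (bscRCU_monotone hp0 hp1 hn ?_)
    gcongr
    exact le_max_left _ _
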